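/- **Setting.** Let $K$ be a field and let $r,s\in K$ be nonzero with $r^2\neq s^2$ (for example $K=\mathbb Q(r,s)$ with $r,s$ indeterminates, or a subfield of $\mathbb C$). Let $\mathfrak g$ be $\mathfrak{sl}_{n+1}$ ($n\ge 1$), $\mathfrak{so}_{2n+1}$, $\mathfrak{sp}_{2n}$ or $\mathfrak{so}_{2n}$ ($n\ge 2$). In terms of an orthonormal basis $\epsilon_1,\epsilon_2,\dots$ let the simple roots be $\alpha_i=\epsilon_i-\epsilon_{i+1}$ for $i<n$ and, respectively, $\alpha_n=\epsilon_n-\epsilon_{n+1},\ \epsilon_n,\ 2\epsilon_n,\ \epsilon_{n-1}+\epsilon_n$. Put $a_{ij}=2(\alpha_i,\alpha_j)/(\alpha_i,\alpha_i)$, and $d_i=(\alpha_i,\alpha_i)$ for $\mathfrak{so}_{2n+1}$, $d_i=(\alpha_i,\alpha_i)/2$ otherwise; $r_i=r^{d_i}$, $s_i=s^{d_i}$. Define $c_{ji}(r,s)$, for $1\le i,j\le n$, as follows. - For $\mathfrak{sl}_{n+1}$: $c_{ji}=r^{(\epsilon_j,\alpha_i)}s^{(\epsilon_{j+1},\alpha_i)}$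 for all $i,j$. - For the other $\mathfrak g$ and $j<n$: $c_{ji}=r_j^{(\epsilon_j,\alpha_i)}s_j^{(\epsilon_{j+1},\alpha_i)}$. - For $\mathfrak{so}_{2n+1}$ and $\mathfrak{sp}_{2n}$: $c_{ni}=r^{2(\epsilon_n,\alpha_i)}$ if $i<n$, and $c_{nn}=r^{(\epsilon_n,\alpha_n)}s^{-(\epsilon_n,\alpha_n)}$. - For $\mathfrak{so}_{2n}$: $c_{ni}=r^{(\epsilon_{n-1},\alpha_i)}s^{-(\epsilon_n,\alpha_i)}$ if $i\ne n-1$, and $c_{n,n-1}=r^{(\epsilon_n,\alpha_{n-1})}s^{-(\epsilon_{n-1},\alpha_{n-1})}$. The two-parameter quantum group $U_{r,s}(\mathfrak g)$ is the unital associative $K$-algebra generated by $e_i,f_i,\omega_i^{\pm1},\omega_i'^{\pm1}$ ($1\le i\le n$) with the following relations. 1. All $\omega_i^{\pm1},\omega_j'^{\pm1}$ commute with one another, and $\omega_i\omega_i^{-1}=\omega_i'\omega_i'^{-1}=1$. 2. $\omega_je_i\omega_j^{-1}=c_{ji}(r,s)\,e_i$ and $\omega_jf_i\omega_j^{-1}=c_{ji}(r,s)^{-1}f_i$.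 3. $\omega_j'e_i\omega_j'^{-1}=c_{ji}(s,r)\,e_i$ and $\omega_j'f_i\omega_j'^{-1}=c_{ji}(s,r)^{-1}f_i$. 4. $e_if_j-f_je_i=\delta_{ij}\dfrac{\omega_i-\omega_i'}{r_i-s_i}$. 5. If $a_{ij}=0$: $e_ie_j=e_je_i$ and $f_if_j=f_jf_i$, except that for $\mathfrak{so}_{2n}$ and $\{i,j\}=\{n-1,n\}$ these are replaced by $e_{n-1}e_n=rs\,e_ne_{n-1}$ and $f_nf_{n-1}=rs\,f_{n-1}f_n$. 6. For $i\neq j$ put $(a,b)=(r_i,s_i)$ if $i<j$ and $(a,b)=(r_i^{-1},s_i^{-1})$ if $i>j$. If $a_{ij}=-1$: $$e_i^2e_j-(a+b)e_ie_je_i+ab\,e_je_i^2=0,\qquad f_jf_i^2-(a+b)f_if_jf_i+ab\,f_i^2f_j=0.$$ If $a_{ij}=-2$, with $t=a^2+ab+b^2$: $$e_i^3e_j-t\,e_i^2e_je_i+ab\,t\,e_ie_je_i^2-(ab)^3e_je_i^3=0,\qquad f_jf_i^3-t\,f_if_jf_i^2+ab\,t\,f_i^2f_jf_i-(ab)^3f_i^3f_j=0.$$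 Let $U_{r,s}(\mathfrak n)$, $U_{r,s}(\mathfrak n^-)$ and $U^0$ be the subalgebras of $U_{r,s}(\mathfrak g)$ generated by the $e_i$, by the $f_i$, and by the $\omega_i^{\pm1},\omega_i'^{\pm1}$, respectively. For $q\in K$ with $q\ne0$ and $q^4\neq1$, put $q_i=q^{d_i}$ and let $U_q(\mathfrak g)$ be the Drinfel'd–Jimbo algebra with generators $E_i,F_i,K_i^{\pm1}$ and relations $K_iK_j=K_jK_i$, $K_iK_i^{-1}=K_i^{-1}K_i=1$, $K_iE_jK_i^{-1}=q_i^{a_{ij}}E_j$, $K_iF_jK_i^{-1}=q_i^{-a_{ij}}F_j$, $E_iF_j-F_jE_i=\delta_{ij}\frac{K_i-K_i^{-1}}{q_i-q_i^{-1}}$ and, for $i\ne j$ and $m=1-a_{ij}$, $\sum_{k=0}^{m}(-1)^k\left[{m\atop k}\right]_{q_i}E_i^{m-k}E_jE_i^k=0$, and the same with $F$ in place of $E$; here $\left[{m\atop k}\right]_q$ is the Gaussian binomial coefficient that is symmetric under $q\mapsto q^{-1}$. Let $U_q(\mathfrak n)$, $U_q(\mathfrak n^-)$, $U_0$ be the subalgebras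 generated by the $E_i$, by the $F_i$, and by the $K_i^{\pm1}$. **Corollary 2.6.** (a) $U_{r,s}(\mathfrak g)\cong U_{r,s}(\mathfrak n^-)\otimes U^0\otimes U_{r,s}(\mathfrak n)$ as vector spaces, through multiplication: the linear map $y\otimes h\otimes x\mapsto yhx$ is a bijection from the tensor product onto $U_{r,s}(\mathfrak g)$. Moreover $U^0$ is the algebra of Laurent polynomials in the $2n$ independent variables $\omega_1,\dots,\omega_n,\omega_1',\dots,\omega_n'$. (b) In the case $r=q$, $s=q^{-1}$ there is a surjective algebra homomorphism $U_{q,q^{-1}}(\mathfrak g)\to U_q(\mathfrak g)$ with $e_i\mapsto E_i$, $f_i\mapsto F_i$, $\omega_i\mapsto K_i$, $\omega_i'\mapsto K_i^{-1}$, whose kernel is the two-sided ideal generated by the $\omega_i'-\omega_i^{-1}$; and the induced multiplication map $y\otimes h\otimes x\mapsto yhx$ is a linear bijection $U_q(\mathfrak n^-)\otimes U_0\otimes U_q(\mathfrak n)\to U_q(\mathfrak g)$, where $U_0$ is the algebra of Laurent polynomials in the $n$ independent variables $K_1,\dots,K_n$. -/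

import Mathlib

open scoped TensorProduct

noncomputable section

namespace TwoParam

/-- The four classical series. With rank `n` they stand for
`sl_{n+1}` (`A`), `so_{2n+1}` (`B`), `sp_{2n}` (`C`) and `so_{2n}` (`D`). -/
inductive ClassicalType
  | A | B | C | D

/-- The smallest rank that is considered in each series. -/
def ClassicalType.minRank : ClassicalType → ℕ
  | .A => 1
  | .B => 2
  | .C => 2
  | .D => 2

/-! ### Root data

Vertices and basis vectors are numbered from zero: the vertices are `0, …, n - 1` and the
orthonormal basis is `ε 0, ε 1, …`, so that the vertex `i : Fin n` is the vertex number `i + 1`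
in the usual numbering, and likewise for `ε`. -/

/-- The simple root at the vertex `i`, through its coordinates in the orthonormal basis `ε`:
`ε i - ε (i + 1)`, except that at the last vertex it is `ε (n - 1)` in type `B`,
`2 ε (n - 1)` in type `C` and `ε (n - 2) + ε (n - 1)` in type `D`. -/
def simpleRoot (X : ClassicalType) (n : ℕ) (i : Fin n) : ℕ → ℤ :=
  if (i : ℕ) + 1 < n then Pi.single (i : ℕ) 1 - Pi.single ((i : ℕ) + 1) 1
  else match X with
    | .A => Pi.single (i : ℕ) 1 - Pi.single ((i : ℕ) + 1) 1
    | .B => Pi.single (i : ℕ) 1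
    | .C => Pi.single (i : ℕ) 2
    | .D => Pi.single ((i : ℕ) - 1) 1 + Pi.single (i : ℕ) 1

/-- The inner product `(ε k, α i)`. -/
def epsPair (X : ClassicalType) (n k : ℕ) (i : Fin n) : ℤ := simpleRoot X n i k

/-- The inner product `(α i, α j)`; only `ε 0, …, ε n` occur in the simple roots. -/
def rootPair (X : ClassicalType) (n : ℕ) (i j : Fin n) : ℤ :=
  ∑ k ∈ Finset.range (n + 1), simpleRoot X n i k * simpleRoot X n j k

/-- The Cartan integer `a i j = 2 (α i, α j) / (α i, α i)` (the division is exact). -/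
def cartan (X : ClassicalType) (n : ℕ) (i j : Fin n) : ℤ :=
  2 * rootPair X n i j / rootPair X n i i

/-- The exponent `d i` in `r i = r ^ d i`, `s i = s ^ d i`, `q i = q ^ d i`: it is `(α i, α i)` in
type `B` and `(α i, α i) / 2` in the other types (the division is exact). -/
def rootLen (X : ClassicalType) (n : ℕ) (i : Fin n) : ℤ :=
  match X with
  | .B => rootPair X n i i
  | _ => rootPair X n i i / 2

/-! ### The two-parameter quantum group -/

/-- The generators `e i`, `f i`, `ω i`, `(ω i)⁻¹`, `ω' i`, `(ω' i)⁻¹`. -/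
inductive Gen (n : ℕ)
  | e (i : Fin n)
  | f (i : Fin n)
  | w (i : Fin n)
  | wInv (i : Fin n)
  | wp (i : Fin n)
  | wpInv (i : Fin n)

/-- The generators other than the `e i` and `f i`. -/
def Gen.IsToral {n : ℕ} : Gen n → Prop
  | .e _ => False
  | .f _ => False
  | _ => True

section

variable {K : Type*} [Field K]

/-- The scalar `c` in `ω j * e i * (ω j)⁻¹ = c • e i`. -/
def weight (X : ClassicalType) (n : ℕ) (r s : K) (j i : Fin n) : K :=
  match X with
  | .A => r ^ epsPair X n j i * s ^ epsPair X n (j + 1) i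
  | .B =>
    if (j : ℕ) + 1 < n then
      (r ^ rootLen X n j) ^ epsPair X n j i * (s ^ rootLen X n j) ^ epsPair X n (j + 1) i
    else if (i : ℕ) + 1 < n then
      (r ^ rootLen X n j) ^ (2 * epsPair X n (n - 1) i)
    else
      (r ^ rootLen X n j) ^ epsPair X n (n - 1) i * (s ^ rootLen X n j) ^ (-epsPair X n (n - 1) i)
  | .C =>
    if (j : ℕ) + 1 < n then r ^ epsPair X n j i * s ^ epsPair X n (j + 1) i
    else if (i : ℕ) + 1 < n then r ^ (2 * epsPair X n (n - 1) i)
    else r ^ epsPair X n (n - 1) i * s ^ (-epsPair X n (n - 1) i)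
  | .D =>
    if (j : ℕ) + 1 < n then r ^ epsPair X n j i * s ^ epsPair X n (j + 1) i
    else if (i : ℕ) + 2 = n then r ^ epsPair X n (n - 1) i * s ^ (-epsPair X n (n - 2) i)
    else r ^ epsPair X n (n - 2) i * s ^ (-epsPair X n (n - 1) i)

/-- The two parameters that occur in the Serre relation for `(i, j)`: `(r i, s i)` if `i < j`,
and `((r i)⁻¹, (s i)⁻¹)` if `j < i`. -/
def serreParam (X : ClassicalType) (n : ℕ) (r : K) (i j : Fin n) : K :=
  if i < j then r ^ rootLen X n i else (r ^ rootLen X n i)⁻¹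

/-- In type `D`, the vertices `i`, `j` are the last but one and the last. -/
def IsFork (X : ClassicalType) (n : ℕ) (i j : Fin n) : Prop :=
  X = .D ∧ (i : ℕ) + 2 = n ∧ (j : ℕ) + 1 = n

/-- The defining relations of `U_{r,s}(g)` in the free algebra on the generators: the toral
generators commute, `ω i` and `ω' i` are invertible and act diagonally on the `e j` and `f j`, the
commutator relation of `e i` and `f j`, and the `(r, s)`-Serre relations, where the degree of the
relation for `(i, j)` is given by the Cartan integer. For the pair of end vertices of type `D` the
commutation of `e i` and `e j` is deformed by the factor `r * s`. -/
inductive Rel (X : ClassicalType) (n : ℕ) (r s : K) :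
    FreeAlgebra K (Gen n) → FreeAlgebra K (Gen n) → Prop
  | comm (a b : Gen n) (ha : a.IsToral) (hb : b.IsToral) : Rel X n r s
      (FreeAlgebra.ι K a * FreeAlgebra.ι K b) (FreeAlgebra.ι K b * FreeAlgebra.ι K a)
  | w_inv (i : Fin n) : Rel X n r s
      (FreeAlgebra.ι K (.w i) * FreeAlgebra.ι K (.wInv i)) 1
  | wp_inv (i : Fin n) : Rel X n r s
      (FreeAlgebra.ι K (.wp i) * FreeAlgebra.ι K (.wpInv i)) 1
  | w_e (j i : Fin n) : Rel X n r s
      (FreeAlgebra.ι K (.w j) * FreeAlgebra.ι K (.e i) * FreeAlgebra.ι K (.wInv j))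
      (weight X n r s j i • FreeAlgebra.ι K (.e i))
  | w_f (j i : Fin n) : Rel X n r s
      (FreeAlgebra.ι K (.w j) * FreeAlgebra.ι K (.f i) * FreeAlgebra.ι K (.wInv j))
      ((weight X n r s j i)⁻¹ • FreeAlgebra.ι K (.f i))
  | wp_e (j i : Fin n) : Rel X n r s
      (FreeAlgebra.ι K (.wp j) * FreeAlgebra.ι K (.e i) * FreeAlgebra.ι K (.wpInv j))
      (weight X n s r j i • FreeAlgebra.ι K (.e i))
  | wp_f (j i : Fin n) : Rel X n r s
      (FreeAlgebra.ι K (.wp j) * FreeAlgebra.ι K (.f i) * FreeAlgebra.ι K (.wpInv j))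
      ((weight X n s r j i)⁻¹ • FreeAlgebra.ι K (.f i))
  | e_f (i j : Fin n) : Rel X n r s
      (FreeAlgebra.ι K (.e i) * FreeAlgebra.ι K (.f j)
        - FreeAlgebra.ι K (.f j) * FreeAlgebra.ι K (.e i))
      (if i = j then (r ^ rootLen X n i - s ^ rootLen X n i)⁻¹ •
        (FreeAlgebra.ι K (.w i) - FreeAlgebra.ι K (.wp i)) else 0)
  | e_zero (i j : Fin n) (h : cartan X n i j = 0) (hij : ¬ IsFork X n i j)
      (hji : ¬ IsFork X n j i) : Rel X n r s
      (FreeAlgebra.ι K (.e i) * FreeAlgebra.ι K (.e j))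
      (FreeAlgebra.ι K (.e j) * FreeAlgebra.ι K (.e i))
  | f_zero (i j : Fin n) (h : cartan X n i j = 0) (hij : ¬ IsFork X n i j)
      (hji : ¬ IsFork X n j i) : Rel X n r s
      (FreeAlgebra.ι K (.f i) * FreeAlgebra.ι K (.f j))
      (FreeAlgebra.ι K (.f j) * FreeAlgebra.ι K (.f i))
  | e_fork (i j : Fin n) (h : IsFork X n i j) : Rel X n r s
      (FreeAlgebra.ι K (.e i) * FreeAlgebra.ι K (.e j))
      ((r * s) • (FreeAlgebra.ι K (.e j) * FreeAlgebra.ι K (.e i)))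
  | f_fork (i j : Fin n) (h : IsFork X n i j) : Rel X n r s
      (FreeAlgebra.ι K (.f j) * FreeAlgebra.ι K (.f i))
      ((r * s) • (FreeAlgebra.ι K (.f i) * FreeAlgebra.ι K (.f j)))
  | e_one (i j : Fin n) (h : cartan X n i j = -1) (a b : K)
      (ha : a = serreParam X n r i j) (hb : b = serreParam X n s i j) : Rel X n r s
      (FreeAlgebra.ι K (.e i) ^ 2 * FreeAlgebra.ι K (.e j)
        - (a + b) • (FreeAlgebra.ι K (.e i) * FreeAlgebra.ι K (.e j) * FreeAlgebra.ι K (.e i))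
        + (a * b) • (FreeAlgebra.ι K (.e j) * FreeAlgebra.ι K (.e i) ^ 2)) 0
  | f_one (i j : Fin n) (h : cartan X n i j = -1) (a b : K)
      (ha : a = serreParam X n r i j) (hb : b = serreParam X n s i j) : Rel X n r s
      (FreeAlgebra.ι K (.f j) * FreeAlgebra.ι K (.f i) ^ 2
        - (a + b) • (FreeAlgebra.ι K (.f i) * FreeAlgebra.ι K (.f j) * FreeAlgebra.ι K (.f i))
        + (a * b) • (FreeAlgebra.ι K (.f i) ^ 2 * FreeAlgebra.ι K (.f j))) 0
  | e_two (i j : Fin n) (h : cartan X n i j = -2) (a b : K)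
      (ha : a = serreParam X n r i j) (hb : b = serreParam X n s i j) : Rel X n r s
      (FreeAlgebra.ι K (.e i) ^ 3 * FreeAlgebra.ι K (.e j)
        - (a ^ 2 + a * b + b ^ 2) •
          (FreeAlgebra.ι K (.e i) ^ 2 * FreeAlgebra.ι K (.e j) * FreeAlgebra.ι K (.e i))
        + (a * b * (a ^ 2 + a * b + b ^ 2)) •
          (FreeAlgebra.ι K (.e i) * FreeAlgebra.ι K (.e j) * FreeAlgebra.ι K (.e i) ^ 2)
        - (a * b) ^ 3 • (FreeAlgebra.ι K (.e j) * FreeAlgebra.ι K (.e i) ^ 3)) 0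
  | f_two (i j : Fin n) (h : cartan X n i j = -2) (a b : K)
      (ha : a = serreParam X n r i j) (hb : b = serreParam X n s i j) : Rel X n r s
      (FreeAlgebra.ι K (.f j) * FreeAlgebra.ι K (.f i) ^ 3
        - (a ^ 2 + a * b + b ^ 2) •
          (FreeAlgebra.ι K (.f i) * FreeAlgebra.ι K (.f j) * FreeAlgebra.ι K (.f i) ^ 2)
        + (a * b * (a ^ 2 + a * b + b ^ 2)) •
          (FreeAlgebra.ι K (.f i) ^ 2 * FreeAlgebra.ι K (.f j) * FreeAlgebra.ι K (.f i))
        - (a * b) ^ 3 • (FreeAlgebra.ι K (.f i) ^ 3 * FreeAlgebra.ι K (.f j))) 0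

/-- The two-parameter quantum group `U_{r,s}(g)`, as a `K`-algebra. -/
abbrev QGroup (X : ClassicalType) (n : ℕ) (r s : K) : Type _ := RingQuot (Rel X n r s)

/-- The image of a generator in `U_{r,s}(g)`. -/
def gen (X : ClassicalType) (n : ℕ) (r s : K) (a : Gen n) : QGroup X n r s :=
  RingQuot.mkAlgHom K (Rel X n r s) (FreeAlgebra.ι K a)

/-- `U_{r,s}(n)`, the subalgebra generated by the `e i`. -/
def posPart (X : ClassicalType) (n : ℕ) (r s : K) : Subalgebra K (QGroup X n r s) :=
  Algebra.adjoin K (Set.range fun i => gen X n r s (.e i))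

/-- `U_{r,s}(n⁻)`, the subalgebra generated by the `f i`. -/
def negPart (X : ClassicalType) (n : ℕ) (r s : K) : Subalgebra K (QGroup X n r s) :=
  Algebra.adjoin K (Set.range fun i => gen X n r s (.f i))

/-- `U⁰`, the subalgebra generated by the `ω i`, the `ω' i` and their inverses. -/
def torPart (X : ClassicalType) (n : ℕ) (r s : K) : Subalgebra K (QGroup X n r s) :=
  Algebra.adjoin K {x | ∃ a : Gen n, a.IsToral ∧ x = gen X n r s a}

/-! ### The one-parameter quantum group of Drinfeld and Jimbo -/

/-- The generators `E i`, `F i`, `K i`, `(K i)⁻¹`. -/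
inductive DJGen (n : ℕ)
  | e (i : Fin n)
  | f (i : Fin n)
  | k (i : Fin n)
  | kInv (i : Fin n)

/-- The symmetric Gaussian binomial coefficient, by its Pascal recursion
`[m + 1, l + 1] = q ^ (l + 1) [m, l + 1] + q ^ (l - m) [m, l]`; it is invariant under
`q ↦ q⁻¹`, for instance `[2, 1] = q + q⁻¹`. -/
def qBinom (q : K) : ℕ → ℕ → K
  | _, 0 => 1
  | 0, _ + 1 => 0
  | m + 1, l + 1 => q ^ (l + 1) * qBinom q m (l + 1) + q ^ ((l : ℤ) - (m : ℤ)) * qBinom q m l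

/-- The left side `∑ k, (-1) ^ k [m, k] x ^ (m - k) y x ^ k` of a quantum Serre relation, with
`m = 1 - a`. -/
def serreSum {R : Type*} [Ring R] [Algebra K R] (q : K) (a : ℤ) (x y : R) : R :=
  ∑ k ∈ Finset.range ((1 - a).toNat + 1),
    ((-1) ^ k * qBinom q (1 - a).toNat k) • (x ^ ((1 - a).toNat - k) * y * x ^ k)

/-- The defining relations of `U_q(g)`. -/
inductive DJRel (X : ClassicalType) (n : ℕ) (q : K) :
    FreeAlgebra K (DJGen n) → FreeAlgebra K (DJGen n) → Prop
  | comm (i j : Fin n) : DJRel X n q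
      (FreeAlgebra.ι K (.k i) * FreeAlgebra.ι K (.k j))
      (FreeAlgebra.ι K (.k j) * FreeAlgebra.ι K (.k i))
  | k_inv (i : Fin n) : DJRel X n q
      (FreeAlgebra.ι K (.k i) * FreeAlgebra.ι K (.kInv i)) 1
  | inv_k (i : Fin n) : DJRel X n q
      (FreeAlgebra.ι K (.kInv i) * FreeAlgebra.ι K (.k i)) 1
  | k_e (i j : Fin n) : DJRel X n q
      (FreeAlgebra.ι K (.k i) * FreeAlgebra.ι K (.e j) * FreeAlgebra.ι K (.kInv i))
      ((q ^ rootLen X n i) ^ cartan X n i j • FreeAlgebra.ι K (.e j))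
  | k_f (i j : Fin n) : DJRel X n q
      (FreeAlgebra.ι K (.k i) * FreeAlgebra.ι K (.f j) * FreeAlgebra.ι K (.kInv i))
      ((q ^ rootLen X n i) ^ (-cartan X n i j) • FreeAlgebra.ι K (.f j))
  | e_f (i j : Fin n) : DJRel X n q
      (FreeAlgebra.ι K (.e i) * FreeAlgebra.ι K (.f j)
        - FreeAlgebra.ι K (.f j) * FreeAlgebra.ι K (.e i))
      (if i = j then (q ^ rootLen X n i - (q ^ rootLen X n i)⁻¹)⁻¹ •
        (FreeAlgebra.ι K (.k i) - FreeAlgebra.ι K (.kInv i)) else 0)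
  | serre_e (i j : Fin n) (h : i ≠ j) : DJRel X n q
      (serreSum (q ^ rootLen X n i) (cartan X n i j)
        (FreeAlgebra.ι K (.e i)) (FreeAlgebra.ι K (.e j))) 0
  | serre_f (i j : Fin n) (h : i ≠ j) : DJRel X n q
      (serreSum (q ^ rootLen X n i) (cartan X n i j)
        (FreeAlgebra.ι K (.f i)) (FreeAlgebra.ι K (.f j))) 0

/-- The Drinfeld–Jimbo quantum group `U_q(g)`, as a `K`-algebra. -/
abbrev DJGroup (X : ClassicalType) (n : ℕ) (q : K) : Type _ := RingQuot (DJRel X n q)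

/-- The image of a generator in `U_q(g)`. -/
def djGen (X : ClassicalType) (n : ℕ) (q : K) (a : DJGen n) : DJGroup X n q :=
  RingQuot.mkAlgHom K (DJRel X n q) (FreeAlgebra.ι K a)

/-- `U_q(n)`, the subalgebra generated by the `E i`. -/
def djPosPart (X : ClassicalType) (n : ℕ) (q : K) : Subalgebra K (DJGroup X n q) :=
  Algebra.adjoin K (Set.range fun i => djGen X n q (.e i))

/-- `U_q(n⁻)`, the subalgebra generated by the `F i`. -/
def djNegPart (X : ClassicalType) (n : ℕ) (q : K) : Subalgebra K (DJGroup X n q) :=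
  Algebra.adjoin K (Set.range fun i => djGen X n q (.f i))

/-- `U_0`, the subalgebra generated by the `K i` and their inverses. -/
def djTorPart (X : ClassicalType) (n : ℕ) (q : K) : Subalgebra K (DJGroup X n q) :=
  Algebra.adjoin K
    ((Set.range fun i => djGen X n q (.k i)) ∪ (Set.range fun i => djGen X n q (.kInv i)))

end

end TwoParam

end

noncomputable section

set_option maxSynthPendingDepth 3

/-! ### Weight data and skew derivations of the free algebra -/

namespace Triangular

/-! Both decompositions are instances of one statement about an algebra `A` generated by elements `e
i`, `f i` and commuting toral elements `k γ`, where `γ` runs through a lattice. The toral elements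
act diagonally, `[e i, f i] = κ i (k (a i) - k (b i))`, and further relations are imposed on the `e
i` alone and, read backwards, on the `f i` alone. Spanning is easy: the products `y h x` form a left
ideal that contains `1`. Independence is the real content.

Independence is proved by constructing the left regular representation in advance. Let `Nil` be the
algebra on the `e i` with the given relators, and put `Mod = Nil ⊗ K[Γ] ⊗ Nil`, the left factor
standing for the negative part by way of an anti-homomorphism. Operators on `Mod` are read off from
the way `e i`, `f i` and `k γ` would multiply a product `y h x` from the left. If they satisfy the
defining relations, then `A` acts on `Mod`, and `y h x` sends `1 ⊗ 1 ⊗ 1` to `y ⊗ h ⊗ x`; hence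
multiplication `Mod → A` is injective (`mulMap_injective`).

Moving `e i` across a word in the `f j` produces two skew derivations, one for `k (a i)` and one for
`k (b i)`. They descend to `Nil` exactly when they carry the relators into the ideal of relations;
here they even annihilate them. The same formula, applied to a relator in the operators of the `e
i`, shows that it commutes with the operators of the `f j`. As it also kills `1 ⊗ 1 ⊗ x`, it
vanishes everywhere (`lift_opE_relator`).

For the quantum groups what remains is therefore a computation: the Serre relators are annihilated
by the skew derivations (`skew_serreRelator`). Up to order, the two parameters of a Serre relation
are the ones that govern the weights of its two generators, which forces the cancellation. The
second family of derivations arises from the first on exchanging `r` and `s`, under which the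
relators are stable.

At `r = q`, `s = q⁻¹` the weights become `q_i ^ a_ij` and the relators become the Drinfeld–Jimbo
ones. Only the torus differs, having rank `n` instead of `2n`. Comparing the two universal
properties gives the specialization map, and its kernel is found by constructing the induced map in
the opposite direction, from `U_q(g)` to the quotient. -/

/-- The numerical data of an algebra with generators `e i`, `f i` and a torus `Γ`: the weight
`χ γ i` of `e i`, and the commutator `[e i, f i] = κ i (k (a i) - k (b i))`. -/
structure WeightData (K I Γ : Type*) [Field K] [AddCommGroup Γ] where
  χ : Γ → I → K
  χ_zero : ∀ i, χ 0 i = 1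
  χ_add : ∀ γ δ i, χ (γ + δ) i = χ γ i * χ δ i
  a : I → Γ
  b : I → Γ
  κ : I → K

namespace WeightData

variable {K I Γ : Type*} [Field K] [AddCommGroup Γ] (D : WeightData K I Γ)

lemma χ_mul_neg (γ : Γ) (i : I) : D.χ γ i * D.χ (-γ) i = 1 := by
  rw [← D.χ_add, add_neg_cancel, D.χ_zero]

lemma χ_neg_mul (γ : Γ) (i : I) : D.χ (-γ) i * D.χ γ i = 1 := by
  rw [← D.χ_add, neg_add_cancel, D.χ_zero]

/-- The algebra endomorphism `e i ↦ χ (-γ) i • e i` of the free algebra. -/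
def twist (γ : Γ) : FreeAlgebra K I →ₐ[K] FreeAlgebra K I :=
  FreeAlgebra.lift K fun i => D.χ (-γ) i • FreeAlgebra.ι K i

@[simp] lemma twist_ι (γ : Γ) (i : I) :
    D.twist γ (FreeAlgebra.ι K i) = D.χ (-γ) i • FreeAlgebra.ι K i := by simp [twist]

lemma twist_zero (x : FreeAlgebra K I) : D.twist 0 x = x := by
  have : D.twist 0 = AlgHom.id K _ := by
    ext i
    simp [D.χ_zero]
  simp [this]

lemma twist_add (γ δ : Γ) (x : FreeAlgebra K I) :
    D.twist (γ + δ) x = D.twist γ (D.twist δ x) := by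
  have : D.twist (γ + δ) = (D.twist γ).comp (D.twist δ) := by
    ext i
    simp [add_comm (-δ), D.χ_add, smul_smul, mul_comm]
  simp [this]

variable [DecidableEq I]

/-- The algebra homomorphism `x ↦ !![twist γ x, ∂ x; 0, x]`, where `∂` is the skew derivation
with `∂ (e j) = δ i j`. -/
def skewMatrix (γ : Γ) (i : I) : FreeAlgebra K I →ₐ[K] Matrix (Fin 2) (Fin 2) (FreeAlgebra K I) :=
  FreeAlgebra.lift K fun j =>
    !![D.χ (-γ) j • FreeAlgebra.ι K j, if j = i then 1 else 0; 0, FreeAlgebra.ι K j]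

/-- The skew derivation `∂ (x y) = ∂ x * y + twist γ x * ∂ y` with `∂ (e j) = δ i j`. -/
def skew (γ : Γ) (i : I) : FreeAlgebra K I →ₗ[K] FreeAlgebra K I where
  toFun x := D.skewMatrix γ i x 0 1
  map_add' x y := by simp
  map_smul' c x := by simp

/-- A skew Leibniz rule is multiplicativity of an upper triangular matrix. The corner entry is
`skew` by definition, so only the other three entries need an induction. -/
lemma skewMatrix_apply (γ : Γ) (i : I) (x : FreeAlgebra K I) :
    D.skewMatrix γ i x = !![D.twist γ x, D.skew γ i x; 0, x] := by
  have key : D.skewMatrix γ i x 0 0 = D.twist γ x ∧ D.skewMatrix γ i x 1 0 = 0 ∧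
      D.skewMatrix γ i x 1 1 = x := by
    induction x using FreeAlgebra.induction with
    | grade0 r => simp [Matrix.algebraMap_matrix_apply]
    | grade1 j => simp [skewMatrix]
    | mul x y hx hy =>
      simp [Matrix.mul_apply, Fin.sum_univ_two, hx, hy]
    | add x y hx hy => simp [hx, hy]
  ext k l
  fin_cases k <;> fin_cases l
  · exact key.1
  · rfl
  · exact key.2.1
  · exact key.2.2

@[simp] lemma skew_ι (γ : Γ) (i j : I) :
    D.skew γ i (FreeAlgebra.ι K j) = if j = i then 1 else 0 := by
  simp [skew, skewMatrix]

lemma skew_mul (γ : Γ) (i : I) (x y : FreeAlgebra K I) :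
    D.skew γ i (x * y) = D.skew γ i x * y + D.twist γ x * D.skew γ i y := by
  change D.skewMatrix γ i (x * y) 0 1 = _
  rw [map_mul, skewMatrix_apply, skewMatrix_apply]
  simp [Matrix.mul_apply, Fin.sum_univ_two, add_comm]

@[simp] lemma skew_algebraMap (γ : Γ) (i : I) (r : K) :
    D.skew γ i (algebraMap K _ r) = 0 := by
  simp [skew, Matrix.algebraMap_matrix_apply]

@[simp] lemma skew_one (γ : Γ) (i : I) : D.skew γ i 1 = 0 := by
  rw [← map_one (algebraMap K (FreeAlgebra K I)), skew_algebraMap]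

/-- A skew derivation removes one letter `e i`, so it commutes with the torus action up to the
weight of that letter. -/
lemma twist_skew (γ δ : Γ) (i : I) (x : FreeAlgebra K I) :
    D.twist γ (D.skew δ i x) = D.χ γ i • D.skew δ i (D.twist γ x) := by
  induction x using FreeAlgebra.induction with
  | grade0 r => simp
  | grade1 j =>
    by_cases h : j = i
    · subst h; simp [smul_smul, D.χ_mul_neg]
    · simp [h]
  | mul x y hx hy =>
    have : D.twist γ (D.twist δ x) = D.twist δ (D.twist γ x) := by
      rw [← twist_add, ← twist_add, add_comm]
    simp [skew_mul, hx, hy, this]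
  | add x y hx hy => simp [hx, hy]

end WeightData

/-- Weight data together with a set of relators for the `e i`, which are homogeneous and which all
skew derivations that occur in commutators with the `f i` annihilate. The relators for the `f i` are
the same ones, read backwards. -/
structure Datum (K I Γ : Type*) [Field K] [AddCommGroup Γ] [DecidableEq I] extends
    WeightData K I Γ where
  S : Set (FreeAlgebra K I)
  homogeneous : ∀ s ∈ S, ∀ γ, ∃ c : K, toWeightData.twist γ s = c • s
  skew_a : ∀ s ∈ S, ∀ i, toWeightData.skew (a i) i s = 0
  skew_b : ∀ s ∈ S, ∀ i, toWeightData.skew (b i) i s = 0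
  augmented : ∀ s ∈ S, FreeAlgebra.lift K (fun _ : I => (0 : K)) s = 0

/-! ### Reading words backwards -/

section Reverse

variable {K I A : Type*} [Field K] [Ring A] [Algebra K A]

/-- The anti-homomorphism from the free algebra with given values on the generators. -/
def revLift (f : I → A) : FreeAlgebra K I →ₗ[K] A where
  toFun x := (FreeAlgebra.lift K (fun i => MulOpposite.op (f i)) x).unop
  map_add' x y := by simp
  map_smul' c x := by simp

@[simp] lemma revLift_ι (f : I → A) (i : I) : revLift f (FreeAlgebra.ι K i) = f i := by
  simp [revLift]

@[simp] lemma revLift_mul (f : I → A) (x y : FreeAlgebra K I) :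
    revLift f (x * y) = revLift f y * revLift f x := by
  simp [revLift]

@[simp] lemma revLift_algebraMap (f : I → A) (r : K) :
    revLift f (algebraMap K (FreeAlgebra K I) r) = algebraMap K A r := by
  simp [revLift]

@[simp] lemma revLift_one (f : I → A) : revLift f (1 : FreeAlgebra K I) = 1 := by
  simp [revLift]

lemma op_revLift (f : I → A) (x : FreeAlgebra K I) :
    MulOpposite.op (revLift f x) = FreeAlgebra.lift K (fun i => MulOpposite.op (f i)) x := rfl

@[simp] lemma revLift_pow (f : I → A) (x : FreeAlgebra K I) (m : ℕ) :
    revLift f (x ^ m) = revLift f x ^ m := by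
  simp [revLift]

end Reverse

/-! ### Commutation formulas in an arbitrary representation -/

section Rep

variable {K I Γ A : Type*} [Field K] [AddCommGroup Γ] [DecidableEq I] [Ring A] [Algebra K A]

/-- Elements `e i`, `f i`, `k γ` of an algebra that satisfy the relations given by weight data. -/
structure IsRep (D : WeightData K I Γ) (e f : I → A) (k : Γ → A) : Prop where
  k_zero : k 0 = 1
  k_add : ∀ γ δ, k (γ + δ) = k γ * k δ
  k_e : ∀ γ i, k γ * e i = D.χ γ i • (e i * k γ)
  k_f : ∀ γ i, k γ * f i = D.χ (-γ) i • (f i * k γ)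
  e_f : ∀ i j, e i * f j - f j * e i = if i = j then D.κ i • (k (D.a i) - k (D.b i)) else 0

namespace IsRep

variable {D : WeightData K I Γ} {e f : I → A} {k : Γ → A} (h : IsRep D e f k)
include h

lemma lift_mul_k (γ : Γ) (x : FreeAlgebra K I) :
    FreeAlgebra.lift K e x * k γ = k γ * FreeAlgebra.lift K e (D.twist γ x) := by
  induction x using FreeAlgebra.induction with
  | grade0 r => simp [Algebra.commutes]
  | grade1 j => simp [h.k_e, smul_smul, D.χ_neg_mul]
  | mul x y hx hy => simp only [map_mul]; rw [mul_assoc, hy, ← mul_assoc, hx, mul_assoc]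
  | add x y hx hy => simp [add_mul, mul_add, hx, hy]

/-- The `f i` have the opposite weights and stand on the other side of `k γ`; the two changes
cancel, so that the twist is the one that occurs for the `e i`. -/
lemma k_mul_revLift (γ : Γ) (x : FreeAlgebra K I) :
    k γ * revLift f x = revLift f (D.twist γ x) * k γ := by
  induction x using FreeAlgebra.induction with
  | grade0 r => simp [Algebra.commutes]
  | grade1 j => simp [h.k_f]
  | mul x y hx hy => simp only [map_mul, revLift_mul]; rw [← mul_assoc, hy, mul_assoc, hx, mul_assoc]
  | add x y hx hy => simp [add_mul, mul_add, hx, hy]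

/-- Since `[xy, f] = x [y, f] + [x, f] y`, and moving `k` to the left across `x` twists `x`, both
sides obey the same skew Leibniz rule. This is what dictates the definition of `skew`. -/
lemma lift_commutator (i : I) (x : FreeAlgebra K I) :
    FreeAlgebra.lift K e x * f i - f i * FreeAlgebra.lift K e x =
      D.κ i • (k (D.a i) * FreeAlgebra.lift K e (D.skew (D.a i) i x)
        - k (D.b i) * FreeAlgebra.lift K e (D.skew (D.b i) i x)) := by
  induction x using FreeAlgebra.induction with
  | grade0 r => simp [Algebra.commutes]
  | grade1 j =>
    simp only [FreeAlgebra.lift_ι_apply, h.e_f, D.skew_ι]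
    split_ifs with hj
    · subst hj; simp
    · simp
  | mul x y hx hy =>
    simp only [map_mul, D.skew_mul, map_add, mul_add]
    rw [← mul_assoc (k _) (FreeAlgebra.lift K e (D.twist _ x)), ← h.lift_mul_k,
      ← mul_assoc (k _) (FreeAlgebra.lift K e (D.twist _ x)), ← h.lift_mul_k]
    have e1 := congrArg (FreeAlgebra.lift K e x * ·) hy
    have e2 := congrArg (· * FreeAlgebra.lift K e y) hx
    simp only [mul_sub, sub_mul, smul_sub, mul_smul_comm, smul_mul_assoc, ← mul_assoc] at e1 e2
    simp only [smul_sub, smul_add, ← mul_assoc]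
    linear_combination (norm := module) e1 + e2
  | add x y hx hy =>
    simp only [map_add, add_mul, mul_add]
    linear_combination (norm := module) hx + hy

/-- The reversal of words and the passage of `k` to the right balance each other, so the skew
derivations are literally those of `lift_commutator`. One condition on the relators thus serves both
halves. -/
lemma revLift_commutator (i : I) (x : FreeAlgebra K I) :
    e i * revLift f x - revLift f x * e i =
      D.κ i • (revLift f (D.skew (D.a i) i x) * k (D.a i)
        - revLift f (D.skew (D.b i) i x) * k (D.b i)) := by
  induction x using FreeAlgebra.induction with
  | grade0 r => simp [Algebra.commutes]
  | grade1 j =>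
    simp only [revLift_ι, h.e_f, D.skew_ι]
    by_cases hj : j = i
    · subst hj; simp
    · simp [hj, Ne.symm hj]
  | mul x y hx hy =>
    simp only [D.skew_mul, map_add, add_mul, revLift_mul]
    have e1 := congrArg (· * revLift f x) hy
    have e2 := congrArg (revLift f y * ·) hx
    simp only [mul_sub, sub_mul, smul_sub, mul_smul_comm, smul_mul_assoc, mul_assoc,
      h.k_mul_revLift] at e1 e2
    simp only [smul_sub, smul_add, mul_assoc]
    linear_combination (norm := module) e1 + e2
  | add x y hx hy =>
    simp only [map_add, add_mul, mul_add]
    linear_combination (norm := module) hx + hy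

end IsRep

end Rep

end Triangular

/-! ### The standard module and its operators -/

namespace Triangular

namespace Datum

variable {K I Γ : Type*} [Field K] [AddCommGroup Γ] [DecidableEq I] (D : Datum K I Γ)

/-- The algebra with generators `e i` and the given relators. -/
def Nil : Type _ := RingQuot fun x y : FreeAlgebra K I => x ∈ D.S ∧ y = 0

instance : Ring D.Nil :=
  inferInstanceAs (Ring (RingQuot fun x y : FreeAlgebra K I => x ∈ D.S ∧ y = 0))

instance : Algebra K D.Nil :=
  inferInstanceAs (Algebra K (RingQuot fun x y : FreeAlgebra K I => x ∈ D.S ∧ y = 0))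

/-- The projection of the free algebra. -/
def proj : FreeAlgebra K I →ₐ[K] D.Nil :=
  RingQuot.mkAlgHom K fun x y : FreeAlgebra K I => x ∈ D.S ∧ y = 0

lemma proj_surjective : Function.Surjective D.proj := RingQuot.mkAlgHom_surjective K _

lemma proj_relator {s : FreeAlgebra K I} (hs : s ∈ D.S) : D.proj s = 0 := by
  have := RingQuot.mkAlgHom_rel K (s := fun x y : FreeAlgebra K I => x ∈ D.S ∧ y = 0)
    (x := s) (y := 0) ⟨hs, rfl⟩
  rwa [map_zero] at this

section Lift

variable {B : Type*} [Semiring B] [Algebra K B]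

/-- An algebra homomorphism out of `Nil` from one that annihilates the relators. -/
def liftNil (g : FreeAlgebra K I →ₐ[K] B) (hg : ∀ s ∈ D.S, g s = 0) : D.Nil →ₐ[K] B :=
  RingQuot.liftAlgHom K ⟨g, by rintro x y ⟨hx, rfl⟩; rw [hg x hx, map_zero]⟩

@[simp] lemma liftNil_proj (g : FreeAlgebra K I →ₐ[K] B) (hg : ∀ s ∈ D.S, g s = 0)
    (x : FreeAlgebra K I) : D.liftNil g hg (D.proj x) = g x :=
  RingQuot.liftAlgHom_mkAlgHom_apply K _ _ _

end Lift

variable (K) in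
/-- The monomial of `γ` in the group algebra. -/
abbrev mono (γ : Γ) : AddMonoidAlgebra K Γ := AddMonoidAlgebra.single γ 1

/-- The twist on `Nil`. -/
def twistN (γ : Γ) : D.Nil →ₐ[K] D.Nil :=
  D.liftNil (D.proj.comp (D.twist γ)) fun s hs => by
    obtain ⟨c, hc⟩ := D.homogeneous s hs γ
    simp only [AlgHom.comp_apply, hc, map_smul, D.proj_relator hs, smul_zero]

@[simp] lemma twistN_proj (γ : Γ) (x : FreeAlgebra K I) :
    D.twistN γ (D.proj x) = D.proj (D.twist γ x) := by simp [twistN]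

/-- The skew derivation on `Nil`. -/
def skewN (γ : Γ) (i : I) (h : ∀ s ∈ D.S, D.skew γ i s = 0) : D.Nil →ₗ[K] D.Nil where
  toFun x := D.liftNil (D.proj.mapMatrix.comp (D.skewMatrix γ i)) (fun s hs => by
    -- Homogeneity kills the diagonal entry `twist γ s` in `Nil`, and the hypothesis on `skew` kills
    -- the corner.
    obtain ⟨c, hc⟩ := D.homogeneous s hs γ
    rw [AlgHom.comp_apply, D.skewMatrix_apply, hc, h s hs]
    ext k l
    fin_cases k <;> fin_cases l <;> simp [D.proj_relator hs]) x 0 1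
  map_add' x y := by simp
  map_smul' c x := by simp

@[simp] lemma skewN_proj (γ : Γ) (i : I) (h : ∀ s ∈ D.S, D.skew γ i s = 0) (x : FreeAlgebra K I) :
    D.skewN γ i h (D.proj x) = D.proj (D.skew γ i x) := by
  simp [skewN, D.skewMatrix_apply]

/-- The augmentation of `Nil`. -/
def augment : D.Nil →ₐ[K] K := D.liftNil (FreeAlgebra.lift K fun _ => 0) D.augmented

/-- The algebra endomorphism `γ ↦ χ (-γ) i • γ` of the group algebra of the torus. -/
def torTwist (i : I) : AddMonoidAlgebra K Γ →ₐ[K] AddMonoidAlgebra K Γ :=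
  AddMonoidAlgebra.lift K (AddMonoidAlgebra K Γ) Γ
    { toFun γ := AddMonoidAlgebra.single γ.toAdd (D.χ (-γ.toAdd) i)
      map_one' := by simp [D.χ_zero, AddMonoidAlgebra.one_def]
      map_mul' γ δ := by
        rw [AddMonoidAlgebra.single_mul_single, ← D.χ_add, toAdd_mul, neg_add] }

@[simp] lemma torTwist_single (i : I) (γ : Γ) (c : K) :
    D.torTwist i (AddMonoidAlgebra.single γ c) = AddMonoidAlgebra.single γ (D.χ (-γ) i * c) := by
  simp [torTwist, AddMonoidAlgebra.lift_single, mul_comm]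

/-- The module on which the algebra acts; it is to be isomorphic to the algebra. -/
abbrev Mod : Type _ := (D.Nil ⊗[K] AddMonoidAlgebra K Γ) ⊗[K] D.Nil

open TensorProduct in
/-- The operator of `k γ`. -/
def opK (γ : Γ) : Module.End K D.Mod :=
  map (map (D.twistN γ).toLinearMap (LinearMap.mulLeft K (mono K γ)))
    LinearMap.id

open TensorProduct in
/-- The operator of `f i`. -/
def opF (i : I) : Module.End K D.Mod :=
  map (map (LinearMap.mulRight K (D.proj (FreeAlgebra.ι K i))) LinearMap.id) LinearMap.id

open TensorProduct in
/-- The operator of `e i`. -/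
def opE (i : I) : Module.End K D.Mod :=
  map (map LinearMap.id (D.torTwist i).toLinearMap)
      (LinearMap.mulLeft K (D.proj (FreeAlgebra.ι K i))) +
    D.κ i •
      (map (map (D.skewN (D.a i) i fun s hs => D.skew_a s hs i)
          (LinearMap.mulLeft K (mono K (D.a i)))) LinearMap.id -
        map (map (D.skewN (D.b i) i fun s hs => D.skew_b s hs i)
          (LinearMap.mulLeft K (mono K (D.b i)))) LinearMap.id)

lemma opK_tmul (γ : Γ) (y : FreeAlgebra K I) (h : AddMonoidAlgebra K Γ) (x : D.Nil) :
    D.opK γ ((D.proj y ⊗ₜ h) ⊗ₜ x) =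
      (D.proj (D.twist γ y) ⊗ₜ (mono K γ * h)) ⊗ₜ x := by
  simp [opK]

lemma opF_tmul (i : I) (y : D.Nil) (h : AddMonoidAlgebra K Γ) (x : D.Nil) :
    D.opF i ((y ⊗ₜ h) ⊗ₜ x) = ((y * D.proj (FreeAlgebra.ι K i)) ⊗ₜ h) ⊗ₜ x := by
  simp [opF]

lemma opE_tmul (i : I) (y : FreeAlgebra K I) (h : AddMonoidAlgebra K Γ) (x : D.Nil) :
    D.opE i ((D.proj y ⊗ₜ h) ⊗ₜ x) =
      (D.proj y ⊗ₜ D.torTwist i h) ⊗ₜ (D.proj (FreeAlgebra.ι K i) * x) +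
      D.κ i •
        ((D.proj (D.skew (D.a i) i y) ⊗ₜ (mono K (D.a i) * h)) ⊗ₜ x -
          (D.proj (D.skew (D.b i) i y) ⊗ₜ (mono K (D.b i) * h)) ⊗ₜ x) := by
  simp [opE]

lemma mod_ext {M : Type*} [AddCommMonoid M] [Module K M] {g g' : D.Mod →ₗ[K] M}
    (h : ∀ (y : FreeAlgebra K I) (γ : Γ) (x : FreeAlgebra K I),
      g ((D.proj y ⊗ₜ mono K γ) ⊗ₜ D.proj x) =
        g' ((D.proj y ⊗ₜ mono K γ) ⊗ₜ D.proj x)) : g = g' := by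
  refine TensorProduct.ext_threefold fun y t x => ?_
  obtain ⟨y, rfl⟩ := D.proj_surjective y
  obtain ⟨x, rfl⟩ := D.proj_surjective x
  induction t using AddMonoidAlgebra.induction_linear with
  | zero => simp
  | add t u ht hu => simp only [TensorProduct.tmul_add, TensorProduct.add_tmul, map_add, ht, hu]
  | single γ c =>
    have : AddMonoidAlgebra.single γ c = c • AddMonoidAlgebra.single γ (1 : K) := by simp
    rw [this]
    simp only [TensorProduct.tmul_smul, ← TensorProduct.smul_tmul', map_smul, h]

/-- The operators imitate left multiplication on products `y h x`, so each relation becomes an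
identity between twists and skew derivations. -/
lemma isRep_op : IsRep D.toWeightData D.opE D.opF D.opK where
  k_zero := D.mod_ext fun y γ x => by
    rw [opK_tmul, D.twist_zero]
    simp [AddMonoidAlgebra.single_mul_single]
  k_add γ δ := D.mod_ext fun y ε x => by
    rw [Module.End.mul_apply, opK_tmul, opK_tmul, opK_tmul, D.twist_add, ← mul_assoc,
      show mono K (γ + δ) = mono K γ * mono K δ by
        rw [AddMonoidAlgebra.single_mul_single, mul_one]]
  k_e γ i := D.mod_ext fun y ε x => by
    have h1 : ∀ δ, (mono K γ : AddMonoidAlgebra K Γ) *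
        (mono K δ * mono K ε) =
        mono K δ *
          (mono K γ * mono K ε) :=
      fun δ => mul_left_comm _ _ _
    have h2 : (mono K γ * D.torTwist i (mono K ε) :
        AddMonoidAlgebra K Γ) = D.χ γ i •
          D.torTwist i (mono K γ * mono K ε) := by
      simp only [torTwist_single, AddMonoidAlgebra.single_mul_single, AddMonoidAlgebra.smul_single,
        neg_add, D.χ_add, smul_eq_mul, mul_one, one_mul]
      rw [← mul_assoc, D.χ_mul_neg, one_mul]
    rw [Module.End.mul_apply, LinearMap.smul_apply, Module.End.mul_apply, opK_tmul, opE_tmul,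
      opE_tmul, map_add, map_smul, map_sub, opK_tmul, opK_tmul, opK_tmul, D.twist_skew,
      D.twist_skew, h1, h1, h2]
    simp only [TensorProduct.tmul_smul, ← TensorProduct.smul_tmul', map_smul]
    module
  k_f γ i := D.mod_ext fun y ε x => by
    rw [Module.End.mul_apply, LinearMap.smul_apply, Module.End.mul_apply, opF_tmul, ← map_mul,
      opK_tmul, opK_tmul, opF_tmul]
    simp [← TensorProduct.smul_tmul']
  -- By the skew Leibniz rule for `y * e j`, the term in which the last letter is removed is `twist
  -- y`, which is the operator `opK`; all other terms cancel in the commutator.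
  e_f i j := D.mod_ext fun y ε x => by
    rw [LinearMap.sub_apply, Module.End.mul_apply, Module.End.mul_apply, opF_tmul, ← map_mul,
      opE_tmul, opE_tmul, map_add, map_smul, map_sub, opF_tmul, opF_tmul, opF_tmul,
      D.skew_mul, D.skew_mul, D.skew_ι, D.skew_ι]
    by_cases hij : i = j
    · subst hij
      simp only [if_true, LinearMap.smul_apply, LinearMap.sub_apply, opK_tmul, map_add, map_mul,
        mul_one, TensorProduct.add_tmul]
      module
    · simp [hij, Ne.symm hij]

lemma revLift_opF (y : FreeAlgebra K I) (z : D.Nil) (h : AddMonoidAlgebra K Γ) (x : D.Nil) :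
    revLift D.opF y ((z ⊗ₜ h) ⊗ₜ x) = ((z * D.proj y) ⊗ₜ h) ⊗ₜ x := by
  induction y using FreeAlgebra.induction generalizing z with
  | grade0 r =>
    rw [revLift_algebraMap, Module.algebraMap_end_apply, AlgHom.commutes,
      Algebra.algebraMap_eq_smul_one, mul_smul_comm, mul_one, TensorProduct.smul_tmul',
      TensorProduct.smul_tmul']
  | grade1 i => simp [opF_tmul]
  | mul y y' hy hy' => simp [hy, hy', mul_assoc]
  | add y y' hy hy' => simp [hy, hy', mul_add, TensorProduct.add_tmul]

lemma revLift_opF_relator {s : FreeAlgebra K I} (hs : s ∈ D.S) : revLift D.opF s = 0 :=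
  D.mod_ext fun y γ x => by simp [revLift_opF, D.proj_relator hs]

/-- Skew derivations vanish on `1` and the torus twist fixes `1`, so on this slice `opE` is plain
left multiplication in the last factor. -/
lemma lift_opE_vacuum (z : FreeAlgebra K I) (x : D.Nil) :
    FreeAlgebra.lift K D.opE z ((1 ⊗ₜ 1) ⊗ₜ x) = ((1 : D.Nil) ⊗ₜ 1) ⊗ₜ (D.proj z * x) := by
  induction z using FreeAlgebra.induction generalizing x with
  | grade0 r =>
    rw [AlgHom.commutes, AlgHom.commutes, Module.algebraMap_end_apply,
      Algebra.algebraMap_eq_smul_one, smul_mul_assoc, one_mul, TensorProduct.tmul_smul]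
  | grade1 i =>
    rw [← map_one D.proj, FreeAlgebra.lift_ι_apply, opE_tmul]
    simp
  | mul y y' hy hy' => simp [hy, hy', mul_assoc]
  | add y y' hy hy' => simp [hy, hy', add_mul, TensorProduct.tmul_add]

/-- The slice `1 ⊗ 1 ⊗ x` generates the module under the operators of the `f i` and the torus; an
operator that commutes with these up to scalars is therefore determined there. -/
lemma tmul_eq_op (y : FreeAlgebra K I) (γ : Γ) (x : D.Nil) :
    ((D.proj y ⊗ₜ mono K γ) ⊗ₜ x : D.Mod) =
      revLift D.opF y (D.opK γ ((1 ⊗ₜ 1) ⊗ₜ x)) := by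
  rw [← map_one D.proj, opK_tmul, revLift_opF]
  simp

/-- By `lift_commutator` the commutator with `opF i` involves only skew derivatives of the relator,
which are zero. Homogeneity lets the relator pass `opK γ` up to a scalar. It then reaches `1 ⊗ 1 ⊗
x`, where it multiplies by its own image in `Nil`, which is zero. -/
lemma lift_opE_relator {s : FreeAlgebra K I} (hs : s ∈ D.S) : FreeAlgebra.lift K D.opE s = 0 := by
  have hF : ∀ i, Commute (FreeAlgebra.lift K D.opE s) (D.opF i) := fun i => by
    have := D.isRep_op.lift_commutator i s
    rw [D.skew_a s hs, D.skew_b s hs] at this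
    simpa [sub_eq_zero, commute_iff_eq] using this
  have hR : ∀ y : FreeAlgebra K I,
      Commute (FreeAlgebra.lift K D.opE s) (revLift D.opF y) := fun y => by
    induction y using FreeAlgebra.induction with
    | grade0 r => rw [revLift_algebraMap]; exact (Algebra.commutes r _).symm
    | grade1 i => simpa using hF i
    | mul x y hx hy => simpa using hy.mul_right hx
    | add x y hx hy => simpa using hx.add_right hy
  refine D.mod_ext fun y γ x => ?_
  obtain ⟨c, hc⟩ := D.homogeneous s hs γ
  rw [tmul_eq_op, ← Module.End.mul_apply, (hR y).eq, Module.End.mul_apply, ← Module.End.mul_apply _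
    (D.opK γ), D.isRep_op.lift_mul_k, hc, Module.End.mul_apply, map_smul, LinearMap.smul_apply,
    lift_opE_vacuum, D.proj_relator hs]
  simp

end Datum

end Triangular

/-! ### Triangular decomposition of a presented algebra -/

namespace Triangular

/-- Generators in an algebra `A` that satisfy all relations of a datum. -/
structure Model {K I Γ A : Type*} [Field K] [AddCommGroup Γ] [DecidableEq I] [Ring A]
    [Algebra K A] (D : Datum K I Γ) (e f : I → A) (t : AddMonoidAlgebra K Γ →ₐ[K] A) : Prop where
  isRep : IsRep D.toWeightData e f fun γ => t (Datum.mono K γ)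
  lift_relator : ∀ s ∈ D.S, FreeAlgebra.lift K e s = 0
  revLift_relator : ∀ s ∈ D.S, revLift f s = 0

/-- The action of the torus on the standard module. -/
def Datum.opTor {K I Γ : Type*} [Field K] [AddCommGroup Γ] [DecidableEq I] (D : Datum K I Γ) :
    AddMonoidAlgebra K Γ →ₐ[K] Module.End K D.Mod :=
  AddMonoidAlgebra.lift K (Module.End K D.Mod) Γ
    { toFun γ := D.opK γ.toAdd
      map_one' := D.isRep_op.k_zero
      map_mul' _ _ := D.isRep_op.k_add _ _ }

@[simp] lemma Datum.opTor_mono {K I Γ : Type*} [Field K] [AddCommGroup Γ] [DecidableEq I]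
    (D : Datum K I Γ) (γ : Γ) : D.opTor (Datum.mono K γ) = D.opK γ := by
  simp [Datum.opTor, AddMonoidAlgebra.lift_single]

lemma Datum.model_op {K I Γ : Type*} [Field K] [AddCommGroup Γ] [DecidableEq I]
    (D : Datum K I Γ) : Model D D.opE D.opF D.opTor where
  isRep := by simpa using D.isRep_op
  lift_relator _ hs := D.lift_opE_relator hs
  revLift_relator _ hs := D.revLift_opF_relator hs

/-- An algebra `A` presented by a datum: it is generated by the `e i`, the `f i` and the image of
the group algebra of the torus, satisfies the relations, and acts on the standard module. -/
structure Presented {K I Γ A : Type*} [Field K] [AddCommGroup Γ] [DecidableEq I] [Ring A]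
    [Algebra K A] (D : Datum K I Γ) (e f : I → A) (t : AddMonoidAlgebra K Γ →ₐ[K] A) : Prop
    extends Model D e f t where
  generated : Algebra.adjoin K (Set.range e ∪ Set.range f ∪ Set.range t) = ⊤
  acts : ∃ ρ : A →ₐ[K] Module.End K D.Mod, (∀ i, ρ (e i) = D.opE i) ∧ (∀ i, ρ (f i) = D.opF i) ∧
    ∀ γ, ρ (t (Datum.mono K γ)) = D.opK γ

namespace Presented

variable {K I Γ A : Type*} [Field K] [AddCommGroup Γ] [DecidableEq I] [Ring A]
    [Algebra K A] {D : Datum K I Γ} {e f : I → A} {t : AddMonoidAlgebra K Γ →ₐ[K] A}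
    (P : Presented D e f t)

/-- The homomorphism from `Nil` with image the positive part. -/
def pos : D.Nil →ₐ[K] A := D.liftNil (FreeAlgebra.lift K e) P.lift_relator

/-- The anti-homomorphism from `Nil` with image the negative part. -/
def negOp : D.Nil →ₐ[K] Aᵐᵒᵖ :=
  D.liftNil (FreeAlgebra.lift K fun i => MulOpposite.op (f i)) fun s hs => by
    rw [← op_revLift, P.revLift_relator s hs, MulOpposite.op_zero]

/-- The anti-homomorphism `negOp` as a linear map. -/
def neg : D.Nil →ₗ[K] A := (MulOpposite.opLinearEquiv K).symm.toLinearMap ∘ₗ P.negOp.toLinearMap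

@[simp] lemma pos_proj (x : FreeAlgebra K I) : P.pos (D.proj x) = FreeAlgebra.lift K e x := by
  simp [pos]

@[simp] lemma neg_proj (x : FreeAlgebra K I) : P.neg (D.proj x) = revLift f x := by
  simp [neg, negOp, revLift]

lemma range_pos : P.pos.range = Algebra.adjoin K (Set.range e) := by
  have : P.pos.range = (FreeAlgebra.lift K e).range := by
    ext x
    simp only [AlgHom.mem_range]
    constructor
    · rintro ⟨y, rfl⟩
      obtain ⟨y, rfl⟩ := D.proj_surjective y
      exact ⟨y, (P.pos_proj y).symm⟩
    · rintro ⟨y, rfl⟩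
      exact ⟨D.proj y, P.pos_proj y⟩
  rw [this, Algebra.adjoin_range_eq_range_freeAlgebra_lift]

lemma range_neg : LinearMap.range P.neg = (Algebra.adjoin K (Set.range f)).toSubmodule := by
  apply le_antisymm
  · rintro _ ⟨y, rfl⟩
    obtain ⟨y, rfl⟩ := D.proj_surjective y
    rw [neg_proj, Subalgebra.mem_toSubmodule]
    induction y using FreeAlgebra.induction with
    | grade0 r => rw [revLift_algebraMap]; exact Subalgebra.algebraMap_mem _ r
    | grade1 i => rw [revLift_ι]; exact Algebra.subset_adjoin ⟨i, rfl⟩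
    | mul x y hx hy => rw [revLift_mul]; exact mul_mem hy hx
    | add x y hx hy => rw [map_add]; exact add_mem hx hy
  · intro x hx
    rw [Subalgebra.mem_toSubmodule] at hx
    have key : ∃ y : FreeAlgebra K I, revLift f y = x := by
      induction hx using Algebra.adjoin_induction with
      | mem x hx => obtain ⟨i, rfl⟩ := hx; exact ⟨FreeAlgebra.ι K i, revLift_ι f i⟩
      | algebraMap r => exact ⟨algebraMap K _ r, revLift_algebraMap f r⟩
      | add x y _ _ hx hy =>
        obtain ⟨x, rfl⟩ := hx; obtain ⟨y, rfl⟩ := hy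
        exact ⟨x + y, map_add _ _ _⟩
      | mul x y _ _ hx hy =>
        obtain ⟨x, rfl⟩ := hx; obtain ⟨y, rfl⟩ := hy
        exact ⟨y * x, revLift_mul _ _ _⟩
    obtain ⟨y, rfl⟩ := key
    exact ⟨D.proj y, P.neg_proj y⟩

/-- The multiplication map `y ⊗ h ⊗ x ↦ y h x`. -/
def mulMap : D.Mod →ₗ[K] A :=
  LinearMap.mul' K A ∘ₗ TensorProduct.map
    (LinearMap.mul' K A ∘ₗ TensorProduct.map P.neg t.toLinearMap) P.pos.toLinearMap

@[simp] lemma mulMap_tmul (y : D.Nil) (h : AddMonoidAlgebra K Γ) (x : D.Nil) :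
    P.mulMap ((y ⊗ₜ h) ⊗ₜ x) = P.neg y * t h * P.pos x := by
  simp [mulMap]

lemma mulMap_opK (γ : Γ) (v : D.Mod) :
    P.mulMap (D.opK γ v) = t (Datum.mono K γ) * P.mulMap v := by
  suffices h : P.mulMap ∘ₗ D.opK γ = LinearMap.mulLeft K (t (Datum.mono K γ)) ∘ₗ P.mulMap from
    LinearMap.congr_fun h v
  refine D.mod_ext fun y δ x => ?_
  simp only [LinearMap.comp_apply, LinearMap.mulLeft_apply, D.opK_tmul, mulMap_tmul, neg_proj,
    map_mul]
  simp only [← mul_assoc, P.isRep.k_mul_revLift]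

lemma mulMap_opF (i : I) (v : D.Mod) : P.mulMap (D.opF i v) = f i * P.mulMap v := by
  suffices h : P.mulMap ∘ₗ D.opF i = LinearMap.mulLeft K (f i) ∘ₗ P.mulMap from
    LinearMap.congr_fun h v
  refine D.mod_ext fun y δ x => ?_
  simp only [LinearMap.comp_apply, LinearMap.mulLeft_apply, D.opF_tmul, ← map_mul, mulMap_tmul,
    neg_proj, revLift_mul, revLift_ι, mul_assoc]

/-- The first term of `opE` is `e i` after passing both `y` and the torus element; the others are
the commutator of `e i` with `y` from `revLift_commutator`. -/
lemma mulMap_opE (i : I) (v : D.Mod) : P.mulMap (D.opE i v) = e i * P.mulMap v := by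
  suffices h : P.mulMap ∘ₗ D.opE i = LinearMap.mulLeft K (e i) ∘ₗ P.mulMap from
    LinearMap.congr_fun h v
  refine D.mod_ext fun y δ x => ?_
  have h1 : t (D.torTwist i (Datum.mono K δ)) * e i = e i * t (Datum.mono K δ) := by
    have : D.torTwist i (Datum.mono K δ) = D.χ (-δ) i • Datum.mono K δ := by simp
    rw [this, map_smul, smul_mul_assoc, P.isRep.k_e, smul_smul, D.χ_neg_mul, one_smul]
  have h2 := P.isRep.revLift_commutator i y
  rw [sub_eq_iff_eq_add] at h2
  simp only [LinearMap.comp_apply, LinearMap.mulLeft_apply, D.opE_tmul, mulMap_tmul,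
    neg_proj, pos_proj, map_mul, map_add, map_sub, map_smul, FreeAlgebra.lift_ι_apply]
  rw [← mul_assoc (_ * t _) (e i), mul_assoc _ (t _) (e i), h1]
  simp only [← mul_assoc]
  rw [h2]
  simp only [smul_sub, sub_mul, add_mul, smul_mul_assoc, mul_assoc]
  abel

/-- The image is stable under left multiplication by the generators, hence is a left ideal, and it
contains `1`. Quantifying over `v` inside the induction is what makes the product step work. -/
lemma mulMap_surjective : Function.Surjective P.mulMap := by
  have key : ∀ u : A, ∀ v, ∃ w, P.mulMap w = u * P.mulMap v := by
    intro u
    have hu : u ∈ Algebra.adjoin K (Set.range e ∪ Set.range f ∪ Set.range t) := by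
      rw [P.generated]; trivial
    induction hu using Algebra.adjoin_induction with
    | mem u hu =>
      intro v
      obtain (⟨i, rfl⟩ | ⟨i, rfl⟩) | ⟨h, rfl⟩ := hu
      · exact ⟨_, P.mulMap_opE i v⟩
      · exact ⟨_, P.mulMap_opF i v⟩
      · induction h using AddMonoidAlgebra.induction_linear with
        | zero => exact ⟨0, by simp⟩
        | add g h hg hh =>
          obtain ⟨a, ha⟩ := hg
          obtain ⟨b, hb⟩ := hh
          exact ⟨a + b, by rw [map_add, ha, hb, map_add, add_mul]⟩
        | single γ c =>
          refine ⟨c • D.opK γ v, ?_⟩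
          have : AddMonoidAlgebra.single γ c = c • Datum.mono K γ := by simp
          rw [map_smul, P.mulMap_opK, this, map_smul, smul_mul_assoc]
    | algebraMap r =>
      exact fun v => ⟨r • v, by rw [map_smul, Algebra.smul_def]⟩
    | add x y _ _ hx hy =>
      intro v
      obtain ⟨a, ha⟩ := hx v
      obtain ⟨b, hb⟩ := hy v
      exact ⟨a + b, by rw [map_add, ha, hb, add_mul]⟩
    | mul x y _ _ hx hy =>
      intro v
      obtain ⟨a, ha⟩ := hy v
      obtain ⟨b, hb⟩ := hx a
      exact ⟨b, by rw [hb, ha, mul_assoc]⟩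
  intro u
  obtain ⟨w, hw⟩ := key u (((D.proj 1) ⊗ₜ 1) ⊗ₜ (D.proj 1))
  refine ⟨w, hw.trans ?_⟩
  rw [mulMap_tmul, neg_proj, pos_proj]
  simp

/-- Acting on `1 ⊗ 1 ⊗ 1` is a left inverse: `x` fills the last factor, then `h` the middle one,
then `y` the first, with no correction terms in this order. -/
lemma mulMap_injective : Function.Injective P.mulMap := by
  obtain ⟨ρ, hE, hF, hK⟩ := P.acts
  have hρF : ∀ y : FreeAlgebra K I, ρ (revLift f y) = revLift D.opF y := fun y => by
    induction y using FreeAlgebra.induction with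
    | grade0 r => simp
    | grade1 i => simp [hF]
    | mul x y hx hy => simp [hx, hy]
    | add x y hx hy => simp [hx, hy]
  have hρE : ∀ y : FreeAlgebra K I, ρ (FreeAlgebra.lift K e y) = FreeAlgebra.lift K D.opE y := fun y => by
    have : ρ.comp (FreeAlgebra.lift K e) = FreeAlgebra.lift K D.opE := by
      ext i; simp [hE]
    rw [← this, AlgHom.comp_apply]
  have key : (LinearMap.applyₗ (((1 : D.Nil) ⊗ₜ 1) ⊗ₜ 1) ∘ₗ ρ.toLinearMap) ∘ₗ P.mulMap =
      LinearMap.id := D.mod_ext fun y γ x => by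
    simp only [LinearMap.comp_apply, mulMap_tmul, neg_proj, pos_proj, AlgHom.toLinearMap_apply,
      map_mul, hρF, hρE, hK, LinearMap.applyₗ_apply_apply, Module.End.mul_apply,
      D.lift_opE_vacuum, mul_one, LinearMap.id_apply]
    rw [← D.tmul_eq_op]
  exact Function.LeftInverse.injective (g := fun u => ρ u (((1 : D.Nil) ⊗ₜ 1) ⊗ₜ 1))
    fun v => LinearMap.congr_fun key v

/-- The augmentation of the left factor and the trivial character of the torus retract the module
onto its last factor, so injectivity of `mulMap` passes to that factor. The other two factors are
treated likewise. -/
lemma pos_injective : Function.Injective P.pos := by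
  have h : Function.LeftInverse ((TensorProduct.lid K D.Nil).toLinearMap ∘ₗ TensorProduct.map
      (LinearMap.mul' K K ∘ₗ TensorProduct.map D.augment.toLinearMap
        (AddMonoidAlgebra.lift K K Γ 1).toLinearMap) LinearMap.id)
      (fun x : D.Nil => ((1 : D.Nil) ⊗ₜ[K] (1 : AddMonoidAlgebra K Γ)) ⊗ₜ[K] x) := fun x => by simp
  intro x y hxy
  refine h.injective (P.mulMap_injective ?_)
  simp only [mulMap_tmul, hxy]

lemma neg_injective : Function.Injective P.neg := by
  have h : Function.LeftInverse ((TensorProduct.rid K D.Nil).toLinearMap ∘ₗ TensorProduct.map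
      ((TensorProduct.rid K D.Nil).toLinearMap ∘ₗ TensorProduct.map LinearMap.id
        (AddMonoidAlgebra.lift K K Γ 1).toLinearMap) D.augment.toLinearMap)
      (fun x : D.Nil => (x ⊗ₜ[K] (1 : AddMonoidAlgebra K Γ)) ⊗ₜ[K] (1 : D.Nil)) := fun x => by simp
  intro x y hxy
  refine h.injective (P.mulMap_injective ?_)
  simp only [mulMap_tmul, hxy]

include P in
lemma tor_injective : Function.Injective t := by
  have h : Function.LeftInverse ((TensorProduct.rid K (AddMonoidAlgebra K Γ)).toLinearMap ∘ₗ
      TensorProduct.map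
      ((TensorProduct.lid K (AddMonoidAlgebra K Γ)).toLinearMap ∘ₗ TensorProduct.map D.augment.toLinearMap
        LinearMap.id) D.augment.toLinearMap)
      (fun x : AddMonoidAlgebra K Γ => ((1 : D.Nil) ⊗ₜ[K] x) ⊗ₜ[K] (1 : D.Nil)) := fun x => by simp
  intro x y hxy
  refine h.injective (P.mulMap_injective ?_)
  simp only [mulMap_tmul, hxy]

include P in
/-- The triangular decomposition. -/
theorem exists_equiv {Nn T Np : Subalgebra K A} (hn : Nn = Algebra.adjoin K (Set.range f))
    (ht : T = t.range) (hp : Np = Algebra.adjoin K (Set.range e)) :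
    (∃ Φ : ((Nn ⊗[K] T) ⊗[K] Np) ≃ₗ[K] A, ∀ (y : Nn) (h : T) (x : Np),
      Φ ((y ⊗ₜ[K] h) ⊗ₜ[K] x) = (y : A) * (h : A) * (x : A)) ∧
    ∃ Θ : AddMonoidAlgebra K Γ ≃ₐ[K] T, ∀ h, (Θ h : A) = t h := by
  subst ht
  rw [← P.range_pos] at hp
  subst hp
  have hn' : LinearMap.range P.neg = Nn.toSubmodule := by rw [hn, P.range_neg]
  let φn : D.Nil ≃ₗ[K] Nn :=
    (LinearEquiv.ofInjective P.neg P.neg_injective).trans (LinearEquiv.ofEq _ _ hn')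
  let φt : AddMonoidAlgebra K Γ ≃ₐ[K] t.range := AlgEquiv.ofInjective t P.tor_injective
  let φp : D.Nil ≃ₐ[K] P.pos.range := AlgEquiv.ofInjective P.pos P.pos_injective
  refine ⟨⟨(TensorProduct.congr (TensorProduct.congr φn φt.toLinearEquiv) φp.toLinearEquiv).symm.trans
    (LinearEquiv.ofBijective P.mulMap ⟨P.mulMap_injective, P.mulMap_surjective⟩), ?_⟩, φt,
    fun h => rfl⟩
  intro y h x
  obtain ⟨y, rfl⟩ := φn.surjective y
  obtain ⟨h, rfl⟩ := φt.surjective h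
  obtain ⟨x, rfl⟩ := φp.surjective x
  have : (TensorProduct.congr (TensorProduct.congr φn φt.toLinearEquiv) φp.toLinearEquiv)
      ((y ⊗ₜ h) ⊗ₜ x) = (φn y ⊗ₜ φt h) ⊗ₜ φp x := rfl
  rw [← this, LinearEquiv.trans_apply, LinearEquiv.symm_apply_apply]
  exact P.mulMap_tmul y h x

end Presented

end Triangular

/-! ### Root data and the weights of the toral generators -/

namespace TwoParam

section Roots

variable {n : ℕ}

lemma rootPair_comm (X : ClassicalType) (i j : Fin n) : rootPair X n i j = rootPair X n j i := by
  simp only [rootPair, mul_comm]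

lemma rootPair_self {X : ClassicalType} (hn : X.minRank ≤ n) (i : Fin n) :
    rootPair X n i i = if (i : ℕ) + 1 < n then 2 else
      match (generalizing := false) X with
      | .A => 2
      | .B => 1
      | .C => 4
      | .D => 2 := by
  have hi := i.isLt
  cases X <;> simp only [ClassicalType.minRank] at hn <;>
    by_cases h : (i : ℕ) + 1 < n <;>
    simp [rootPair, simpleRoot, h, Pi.single_apply, mul_sub, mul_add, Finset.sum_add_distrib,
      Finset.sum_sub_distrib]
  all_goals grind

lemma rootPair_of_lt {X : ClassicalType} {i j : Fin n} (hij : i < j) :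
    rootPair X n i j = if (j : ℕ) + 1 < n then (if (i : ℕ) + 1 = j then -1 else 0) else
      match (generalizing := false) X with
      | .A => if (i : ℕ) + 1 = j then -1 else 0
      | .B => if (i : ℕ) + 1 = j then -1 else 0
      | .C => if (i : ℕ) + 1 = j then -2 else 0
      | .D => if (i : ℕ) + 2 = j then -1 else 0 := by
  have hj := j.isLt
  have hi : (i : ℕ) + 1 < n := by omega
  have hij' : (i : ℕ) < j := hij
  cases X <;> by_cases h : (j : ℕ) + 1 < n <;>
    simp [rootPair, simpleRoot, h, hi, Pi.single_apply, sub_mul, mul_sub, mul_add,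
      Finset.sum_add_distrib, Finset.sum_sub_distrib] <;> grind

lemma rootLen_eq {X : ClassicalType} (hn : X.minRank ≤ n) (i : Fin n) :
    rootLen X n i = if (i : ℕ) + 1 < n then (match (generalizing := false) X with | .B => 2 | _ => 1) else
      match (generalizing := false) X with
      | .C => 2
      | _ => 1 := by
  cases X <;> simp only [rootLen, rootPair_self hn] <;> split_ifs <;> norm_num

/-- The smaller of two vertices is never the last one, so its root has square length `2`. -/
lemma cartan_of_lt {X : ClassicalType} (hn : X.minRank ≤ n) {i j : Fin n} (hij : i < j) :
    cartan X n i j = rootPair X n i j := by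
  have hi : (i : ℕ) + 1 < n := by have := j.isLt; have : (i : ℕ) < j := hij; omega
  rw [cartan, rootPair_self hn, if_pos hi, Int.mul_ediv_cancel_left _ two_ne_zero]

lemma cartan_of_gt {X : ClassicalType} (hn : X.minRank ≤ n) {i j : Fin n} (hij : i < j) :
    cartan X n j i = if (j : ℕ) + 1 < n then (if (i : ℕ) + 1 = j then -1 else 0) else
      match (generalizing := false) X with
      | .A => if (i : ℕ) + 1 = j then -1 else 0
      | .B => if (i : ℕ) + 1 = j then -2 else 0
      | .C => if (i : ℕ) + 1 = j then -1 else 0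
      | .D => if (i : ℕ) + 2 = j then -1 else 0 := by
  rw [cartan, rootPair_self hn, rootPair_comm, rootPair_of_lt hij]
  cases X <;> simp only <;> split_ifs <;> norm_num

lemma cartan_self {X : ClassicalType} (hn : X.minRank ≤ n) (i : Fin n) : cartan X n i i = 2 := by
  rw [cartan, rootPair_self hn]
  cases X <;> simp only <;> split_ifs <;> norm_num

lemma cartan_cases {X : ClassicalType} (hn : X.minRank ≤ n) {i j : Fin n} (hij : i ≠ j) :
    cartan X n i j = 0 ∨ cartan X n i j = -1 ∨ cartan X n i j = -2 := by
  rcases lt_or_gt_of_ne hij with h | h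
  · rw [cartan_of_lt hn h, rootPair_of_lt h]
    cases X <;> simp only <;> split_ifs <;> simp
  · rw [cartan_of_gt hn h]
    cases X <;> simp only <;> split_ifs <;> simp

/-- Symmetrizability: both sides are the same multiple of the inner product of the two roots. -/
lemma rootLen_mul_cartan {X : ClassicalType} (hn : X.minRank ≤ n) {i j : Fin n} (hij : i < j) :
    rootLen X n j * cartan X n j i = rootLen X n i * cartan X n i j := by
  have hi : (i : ℕ) + 1 < n := by have := j.isLt; have : (i : ℕ) < j := hij; omega
  rw [cartan_of_gt hn hij, cartan_of_lt hn hij, rootPair_of_lt hij, rootLen_eq hn, rootLen_eq hn,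
    if_pos hi]
  cases X <;> simp only <;> split_ifs <;> norm_num

variable {K : Type*} [Field K]

lemma weight_self {X : ClassicalType} (hn : X.minRank ≤ n) (r s : K) (i : Fin n) :
    weight X n r s i i = r ^ rootLen X n i * (s ^ rootLen X n i)⁻¹ := by
  have hi := i.isLt
  have := rootLen_eq hn i
  cases X <;> simp only [ClassicalType.minRank] at hn <;> by_cases h : (i : ℕ) + 1 < n <;>
    simp [weight, this, h, epsPair, simpleRoot, Pi.single_apply] <;>
    split_ifs <;> first | (exfalso; omega) | simp

/-- Away from the fork of type `D`, only one of the two parameters survives in an off-diagonal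
weight: `s` when the toral generator has the smaller index, `r` (in `weight_of_gt`) when it has the
larger. This matches the weights with the parameters of the Serre relations. -/
lemma weight_of_lt {X : ClassicalType} (hn : X.minRank ≤ n) (r s : K) {i j : Fin n} (hij : i < j)
    (hf : ¬ IsFork X n i j) :
    weight X n r s i j = s ^ (-(rootLen X n i * cartan X n i j)) := by
  have hj := j.isLt
  have hij' : (i : ℕ) < j := hij
  have hi : (i : ℕ) + 1 < n := by omega
  rw [cartan_of_lt hn hij, rootPair_of_lt hij, rootLen_eq hn, if_pos hi]
  have := rootLen_eq hn i
  cases X <;> by_cases h : (j : ℕ) + 1 < n <;>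
    simp [weight, this, h, hi, epsPair, simpleRoot, Pi.single_apply, IsFork] at hf ⊢ <;>
    split_ifs <;> first | (exfalso; omega) | simp

lemma weight_of_gt {X : ClassicalType} (hn : X.minRank ≤ n) (r s : K) {i j : Fin n} (hij : i < j)
    (hf : ¬ IsFork X n i j) :
    weight X n r s j i = r ^ (rootLen X n i * cartan X n i j) := by
  have hj := j.isLt
  have hij' : (i : ℕ) < j := hij
  have hi : (i : ℕ) + 1 < n := by omega
  rw [cartan_of_lt hn hij, rootPair_of_lt hij, rootLen_eq hn, if_pos hi]
  have := rootLen_eq hn j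
  cases X <;> by_cases h : (j : ℕ) + 1 < n <;>
    simp [weight, this, h, hi, epsPair, simpleRoot, Pi.single_apply, IsFork] at hf ⊢ <;>
    split_ifs <;> first | (exfalso; omega) | simp

lemma IsFork.lt {X : ClassicalType} {i j : Fin n} (h : IsFork X n i j) : i < j := by
  obtain ⟨-, h1, h2⟩ := h
  exact Fin.lt_def.2 (by omega)

lemma IsFork.cartan {X : ClassicalType} (hn : X.minRank ≤ n) {i j : Fin n} (h : IsFork X n i j) :
    cartan X n i j = 0 ∧ TwoParam.cartan X n j i = 0 := by
  rw [cartan_of_lt hn h.lt, cartan_of_gt hn h.lt, rootPair_of_lt h.lt]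
  obtain ⟨rfl, h1, h2⟩ := h
  simp only
  constructor <;> split_ifs <;> omega

/-- At the fork both parameters survive although the roots are orthogonal; this is the source of the
factor `r * s` in the deformed commutation relation. -/
lemma IsFork.weight {X : ClassicalType} {i j : Fin n} (h : IsFork X n i j) (r s : K) :
    weight X n r s i j = r * s ∧ TwoParam.weight X n r s j i = (r * s)⁻¹ := by
  obtain ⟨rfl, h1, h2⟩ := h
  have hi : (i : ℕ) + 1 < n := by omega
  have hj : ¬ (j : ℕ) + 1 < n := by omega
  simp [TwoParam.weight, hi, hj, h1, epsPair, simpleRoot, Pi.single_apply]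
  split_ifs <;> first | (exfalso; omega) | simp [mul_comm]

lemma weight_ne_zero (X : ClassicalType) {r s : K} (hr : r ≠ 0) (hs : s ≠ 0) (j i : Fin n) :
    weight X n r s j i ≠ 0 := by
  cases X <;> simp only [weight] <;> (try split_ifs) <;>
    first
    | exact mul_ne_zero (zpow_ne_zero _ hr) (zpow_ne_zero _ hs)
    | exact mul_ne_zero (zpow_ne_zero _ (zpow_ne_zero _ hr)) (zpow_ne_zero _ (zpow_ne_zero _ hs))
    | exact zpow_ne_zero _ hr
    | exact zpow_ne_zero _ (zpow_ne_zero _ hr)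

end Roots
end TwoParam

/-! ### Serre relators are annihilated by the skew derivations -/

namespace TwoParam

section Serre

variable {K R : Type*} [Field K] [Ring R] [Algebra K R]

/-- The left side of the Serre relation for a Cartan integer `-1`. -/
def serreOne (a b : K) (x y : R) : R :=
  x ^ 2 * y - (a + b) • (x * y * x) + (a * b) • (y * x ^ 2)

/-- The left side of the Serre relation for a Cartan integer `-2`. -/
def serreTwo (a b : K) (x y : R) : R :=
  x ^ 3 * y - (a ^ 2 + a * b + b ^ 2) • (x ^ 2 * y * x) +
    (a * b * (a ^ 2 + a * b + b ^ 2)) • (x * y * x ^ 2) - (a * b) ^ 3 • (y * x ^ 3)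

lemma serreOne_comm (a b : K) (x y : R) : serreOne a b x y = serreOne b a x y := by
  simp only [serreOne, add_comm a b, mul_comm a b]

lemma serreTwo_comm (a b : K) (x y : R) : serreTwo a b x y = serreTwo b a x y := by
  have : a ^ 2 + a * b + b ^ 2 = b ^ 2 + b * a + a ^ 2 := by ring
  rw [serreTwo, serreTwo, this, mul_comm a b]

lemma serreOne_smul (a b c d : K) (x y : R) :
    serreOne a b (c • x) (d • y) = (c ^ 2 * d) • serreOne a b x y := by
  simp only [serreOne, smul_pow, smul_mul_assoc, mul_smul_comm, smul_smul]
  module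

lemma serreTwo_smul (a b c d : K) (x y : R) :
    serreTwo a b (c • x) (d • y) = (c ^ 3 * d) • serreTwo a b x y := by
  simp only [serreTwo, smul_pow, smul_mul_assoc, mul_smul_comm, smul_smul]
  module

variable {R' : Type*} [Ring R'] [Algebra K R']

lemma map_serreOne (φ : R →ₐ[K] R') (a b : K) (x y : R) :
    φ (serreOne a b x y) = serreOne a b (φ x) (φ y) := by
  simp [serreOne]

lemma map_serreTwo (φ : R →ₐ[K] R') (a b : K) (x y : R) :
    φ (serreTwo a b x y) = serreTwo a b (φ x) (φ y) := by
  simp [serreTwo]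

variable {I Γ : Type*} [AddCommGroup Γ] [DecidableEq I]
  (D : Triangular.WeightData K I Γ) (γ : Γ) (l i j : I)

open FreeAlgebra in
-- Removing `e j` leaves `e i ^ 2` times the value at `t = x` of `t ^ 2 - (x + y) t + x y`, which
-- has the root `x`. Removing one `e i` leaves multiples of `e i * e j` and `e j * e i`, and both
-- coefficients cancel for the stated weights.
lemma skew_serreOne (hij : i ≠ j) {x y : K} (hx : x ≠ 0) (hy : y ≠ 0)
    (hi : l = i → D.χ (-γ) i = y / x ∧ D.χ (-γ) j = y⁻¹) (hj : l = j → D.χ (-γ) i = x) :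
    D.skew γ l (serreOne x y (ι K i) (ι K j)) = 0 := by
  by_cases h1 : i = l
  · subst h1
    obtain ⟨e1, e2⟩ := hi rfl
    simp only [serreOne, pow_succ, pow_zero, one_mul, map_add, map_sub, map_smul,
      D.skew_mul, D.skew_ι, D.twist_ι, if_true, hij.symm, if_false, e1, e2, mul_zero, mul_one,
      zero_mul, add_zero, zero_add, smul_mul_assoc, mul_smul_comm, add_mul, mul_add, smul_add,
      smul_smul, mul_assoc]
    match_scalars <;> field_simp <;> ring
  · by_cases h2 : j = l
    · subst h2
      have e1 := hj rfl
      simp only [serreOne, pow_succ, pow_zero, one_mul, map_add, map_sub, map_smul,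
        D.skew_mul, D.skew_ι, D.twist_ι, if_true, hij, if_false, e1, mul_zero, mul_one,
        zero_mul, add_zero, zero_add, smul_mul_assoc, mul_smul_comm, add_mul,
        smul_smul, mul_assoc]
      match_scalars
      field_simp
      ring
    · simp [serreOne, pow_succ, D.skew_mul, h1, h2]

open FreeAlgebra in
-- Here the polynomial that appears on removing `e j` has the roots `x ^ 2`, `x y`, `y ^ 2`, and it
-- is evaluated at `x ^ 2`.
lemma skew_serreTwo (hij : i ≠ j) {x y : K} (hx : x ≠ 0) (hy : y ≠ 0)
    (hi : l = i → D.χ (-γ) i = y / x ∧ D.χ (-γ) j = (y ^ 2)⁻¹)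
    (hj : l = j → D.χ (-γ) i = x ^ 2) :
    D.skew γ l (serreTwo x y (ι K i) (ι K j)) = 0 := by
  by_cases h1 : i = l
  · subst h1
    obtain ⟨e1, e2⟩ := hi rfl
    simp only [serreTwo, pow_succ (ι K i), pow_zero (ι K i), one_mul, map_add, map_sub, map_smul,
      D.skew_mul, D.skew_ι, D.twist_ι, if_true, hij.symm, if_false, e1, e2, mul_zero, mul_one,
      zero_mul, add_zero, zero_add, smul_mul_assoc, mul_smul_comm, add_mul, mul_add, smul_add,
      smul_smul, mul_assoc]
    match_scalars <;> field_simp <;> ring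
  · by_cases h2 : j = l
    · subst h2
      have e1 := hj rfl
      simp only [serreTwo, pow_succ (ι K i), pow_zero (ι K i), one_mul, map_add, map_sub, map_smul,
        D.skew_mul, D.skew_ι, D.twist_ι, if_true, hij, if_false, e1, mul_zero, mul_one,
        zero_mul, add_zero, zero_add, smul_mul_assoc, mul_smul_comm, add_mul, mul_add,
        smul_smul, mul_assoc]
      match_scalars
      field_simp
      ring
    · simp [serreTwo, pow_succ, D.skew_mul, h1, h2]

end Serre

section Relators

open FreeAlgebra

variable {K : Type*} [Field K] {X : ClassicalType} {n : ℕ}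

/-- The Serre relators for the `e i`; those for the `f i` are the same ones, read backwards. -/
inductive SerreRelator (X : ClassicalType) (n : ℕ) (r s : K) : FreeAlgebra K (Fin n) → Prop
  | zero (i j : Fin n) (h : cartan X n i j = 0) (hij : ¬ IsFork X n i j)
      (hji : ¬ IsFork X n j i) : SerreRelator X n r s (ι K i * ι K j - ι K j * ι K i)
  | fork (i j : Fin n) (h : IsFork X n i j) :
      SerreRelator X n r s (ι K i * ι K j - (r * s) • (ι K j * ι K i))
  | one (i j : Fin n) (h : cartan X n i j = -1) : SerreRelator X n r s
      (serreOne (serreParam X n r i j) (serreParam X n s i j) (ι K i) (ι K j))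
  | two (i j : Fin n) (h : cartan X n i j = -2) : SerreRelator X n r s
      (serreTwo (serreParam X n r i j) (serreParam X n s i j) (ι K i) (ι K j))

/-- The relators depend symmetrically on the parameters, so the derivations attached to `ω'`, whose
weights have `r` and `s` exchanged, need no separate computation. -/
lemma SerreRelator.symm {r s : K} {z : FreeAlgebra K (Fin n)} (h : SerreRelator X n r s z) :
    SerreRelator X n s r z := by
  cases h with
  | zero i j h hij hji => exact .zero i j h hij hji
  | fork i j h => rw [mul_comm r s]; exact .fork i j h
  | one i j h => rw [serreOne_comm]; exact .one i j h
  | two i j h => rw [serreTwo_comm]; exact .two i j h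

lemma ne_of_cartan (hn : X.minRank ≤ n) {i j : Fin n} (h : cartan X n i j ≠ 2) : i ≠ j := by
  rintro rfl
  exact h (cartan_self hn i)

/-- The parameters of a Serre relation in the order in which they occur in the weights. -/
lemma exists_weight (hn : X.minRank ≤ n) {r s : K} (hr : r ≠ 0) (hs : s ≠ 0) {i j : Fin n}
    (hne : i ≠ j) (hij : ¬ IsFork X n i j) (hji : ¬ IsFork X n j i) :
    ∃ x y : K, (serreParam X n r i j = x ∧ serreParam X n s i j = y ∨
      serreParam X n r i j = y ∧ serreParam X n s i j = x) ∧ x ≠ 0 ∧ y ≠ 0 ∧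
      (weight X n r s i i)⁻¹ = y / x ∧ (weight X n r s i j)⁻¹ = y ^ cartan X n i j ∧
      (weight X n r s j i)⁻¹ = x ^ (-cartan X n i j) := by
  have hr' := zpow_ne_zero (rootLen X n i) hr
  have hs' := zpow_ne_zero (rootLen X n i) hs
  rcases lt_or_gt_of_ne hne with h | h
  · refine ⟨r ^ rootLen X n i, s ^ rootLen X n i, .inl ⟨by simp [serreParam, h],
      by simp [serreParam, h]⟩, hr', hs', ?_, ?_, ?_⟩
    · rw [weight_self hn]; field_simp
    · rw [weight_of_lt hn r s h hij, ← zpow_neg, neg_neg, zpow_mul]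
    · rw [weight_of_gt hn r s h hij, zpow_neg, zpow_mul]
  -- For `j < i` the roles are exchanged as well as inverted: `x` comes from `s` and `y` from `r`.
  -- Symmetrizability rewrites the exponents in terms of the vertex `i`.
  · have hg := not_lt.2 h.le
    refine ⟨(s ^ rootLen X n i)⁻¹, (r ^ rootLen X n i)⁻¹, .inr ⟨by simp [serreParam, hg],
      by simp [serreParam, hg]⟩, inv_ne_zero hs', inv_ne_zero hr', ?_, ?_, ?_⟩
    · rw [weight_self hn]; field_simp
    · rw [weight_of_gt hn r s h hji, ← rootLen_mul_cartan hn h, inv_zpow, zpow_mul]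
    · rw [weight_of_lt hn r s h hji, ← rootLen_mul_cartan hn h, inv_zpow, zpow_neg, zpow_neg,
        zpow_mul]

variable {Γ : Type*} [AddCommGroup Γ] (D : Triangular.WeightData K (Fin n) Γ)

/-- Only the letters `i` and `j` can be removed. For the relators of degree two, the weight of the
remaining letter is exactly the commutation factor; the others are brought to the order of
parameters in `exists_weight`. -/
lemma skew_serreRelator (hn : X.minRank ≤ n) {r s : K} (hr : r ≠ 0) (hs : s ≠ 0) {γ : Γ}
    {l : Fin n} (hγ : ∀ j, D.χ (-γ) j = (weight X n r s l j)⁻¹) {z : FreeAlgebra K (Fin n)}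
    (hz : SerreRelator X n r s z) : D.skew γ l z = 0 := by
  cases hz with
  | zero i j h hij hji =>
    have hne := ne_of_cartan hn (i := i) (j := j) (by omega)
    obtain ⟨x, y, -, hx, hy, e1, e2, e3⟩ := exists_weight hn hr hs hne hij hji
    rw [h, zpow_zero] at e2
    rw [h, neg_zero, zpow_zero] at e3
    by_cases h1 : i = l
    · subst h1
      simp [D.skew_mul, hne.symm, hγ, e2]
    · by_cases h2 : j = l
      · subst h2
        simp [D.skew_mul, hne, hγ, e3]
      · simp [D.skew_mul, h1, h2]
  | fork i j h =>
    have hne := h.lt.ne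
    obtain ⟨e1, e2⟩ := h.weight r s
    by_cases h1 : i = l
    · subst h1
      simp only [map_sub, map_smul, D.skew_mul, D.skew_ι, D.twist_ι, hγ, e1, if_true, hne.symm,
        if_false, one_mul, mul_zero, add_zero, zero_mul, zero_add, mul_one, smul_smul]
      rw [mul_inv_cancel₀ (mul_ne_zero hr hs), one_smul, sub_self]
    · by_cases h2 : j = l
      · subst h2
        simp [D.skew_mul, hne, hγ, e2]
      · simp [D.skew_mul, h1, h2]
  | one i j h =>
    have hne := ne_of_cartan hn (i := i) (j := j) (by omega)
    obtain ⟨x, y, hxy, hx, hy, e1, e2, e3⟩ := exists_weight hn hr hs hne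
      (fun hf => by have := (hf.cartan hn).1; omega) (fun hf => by have := (hf.cartan hn).2; omega)
    have hS : serreOne (serreParam X n r i j) (serreParam X n s i j) (ι K i) (ι K j) =
        serreOne x y (ι K i) (ι K j) := by
      rcases hxy with ⟨ha, hb⟩ | ⟨ha, hb⟩ <;> rw [ha, hb]
      exact serreOne_comm _ _ _ _
    rw [h] at e2 e3
    rw [hS]
    refine skew_serreOne D γ l i j hne hx hy ?_ ?_
    · rintro rfl
      exact ⟨by rw [hγ, e1], by rw [hγ, e2, zpow_neg_one]⟩
    · rintro rfl
      rw [hγ, e3, neg_neg, zpow_one]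
  | two i j h =>
    have hne := ne_of_cartan hn (i := i) (j := j) (by omega)
    obtain ⟨x, y, hxy, hx, hy, e1, e2, e3⟩ := exists_weight hn hr hs hne
      (fun hf => by have := (hf.cartan hn).1; omega) (fun hf => by have := (hf.cartan hn).2; omega)
    have hS : serreTwo (serreParam X n r i j) (serreParam X n s i j) (ι K i) (ι K j) =
        serreTwo x y (ι K i) (ι K j) := by
      rcases hxy with ⟨ha, hb⟩ | ⟨ha, hb⟩ <;> rw [ha, hb]
      exact serreTwo_comm _ _ _ _
    rw [h] at e2 e3
    rw [hS]
    refine skew_serreTwo D γ l i j hne hx hy ?_ ?_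
    · rintro rfl
      exact ⟨by rw [hγ, e1], by rw [hγ, e2, zpow_neg]; norm_cast⟩
    · rintro rfl
      rw [hγ, e3, neg_neg]; norm_cast

lemma twist_serreRelator {r s : K} (γ : Γ) {z : FreeAlgebra K (Fin n)}
    (hz : SerreRelator X n r s z) : ∃ c : K, D.twist γ z = c • z := by
  cases hz with
  | zero i j h hij hji =>
    exact ⟨D.χ (-γ) i * D.χ (-γ) j, by simp [smul_smul, smul_sub, mul_comm]⟩
  | fork i j h =>
    exact ⟨D.χ (-γ) i * D.χ (-γ) j, by simp [smul_smul, smul_sub, mul_comm]⟩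
  | one i j h => exact ⟨_, by rw [map_serreOne, D.twist_ι, D.twist_ι, serreOne_smul]⟩
  | two i j h => exact ⟨_, by rw [map_serreTwo, D.twist_ι, D.twist_ι, serreTwo_smul]⟩

lemma augmented_serreRelator {r s : K} {z : FreeAlgebra K (Fin n)}
    (hz : SerreRelator X n r s z) : FreeAlgebra.lift K (fun _ : Fin n => (0 : K)) z = 0 := by
  cases hz <;> simp [serreOne, serreTwo]

/-- Weight data with the Serre relators, for parameters that give the weights of the two-parameter
quantum group. -/
def serreDatum (hn : X.minRank ≤ n) {r s : K} (hr : r ≠ 0) (hs : s ≠ 0)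
    (ha : ∀ i j, D.χ (-D.a i) j = (weight X n r s i j)⁻¹)
    (hb : ∀ i j, D.χ (-D.b i) j = (weight X n s r i j)⁻¹) : Triangular.Datum K (Fin n) Γ where
  toWeightData := D
  S := {z | SerreRelator X n r s z}
  homogeneous _ hz γ := twist_serreRelator D γ hz
  skew_a _ hz i := skew_serreRelator D hn hr hs (ha i) hz
  skew_b _ hz i := skew_serreRelator D hn hs hr (hb i) hz.symm
  augmented _ hz := augmented_serreRelator hz

end Relators

end TwoParam

/-! ### Lattice tori -/

namespace Triangular

section Torus

variable {K J A : Type*} [Field K] [Ring A] [Algebra K A]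

lemma lattice_induction {Q : (J →₀ ℤ) → Prop} (h0 : Q 0) (hadd : ∀ γ δ, Q γ → Q δ → Q (γ + δ))
    (hpos : ∀ j, Q (Finsupp.single j 1)) (hneg : ∀ j, Q (-Finsupp.single j 1)) (γ : J →₀ ℤ) :
    Q γ := by
  induction γ using Finsupp.induction_linear with
  | zero => exact h0
  | add γ δ hγ hδ => exact hadd γ δ hγ hδ
  | single j m =>
    induction m using Int.induction_on with
    | zero => simpa using h0
    | succ m hm => rw [Finsupp.single_add]; exact hadd _ _ hm (hpos j)
    | pred m hm =>
      rw [sub_eq_add_neg, Finsupp.single_add]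
      exact hadd _ _ hm (by rw [Finsupp.single_neg]; exact hneg j)

/-- Commuting units are the values of a homomorphism from the group algebra of a lattice. -/
lemma exists_torus (u : J → Aˣ) (hu : ∀ i j, u i * u j = u j * u i) :
    ∃ t : AddMonoidAlgebra K (J →₀ ℤ) →ₐ[K] A,
      (∀ j, t (Datum.mono K (Finsupp.single j 1)) = u j) ∧
      (∀ j, t (Datum.mono K (-Finsupp.single j 1)) = ↑(u j)⁻¹) := by
  -- The universal property of the free abelian group needs a commutative target; the subgroup
  -- generated by the commuting units provides one.
  let G := Subgroup.closure (Set.range u)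
  have hG : ∀ x y : G, x * y = y * x := fun x y => by
    have := Subgroup.isMulCommutative_closure (k := Set.range u) (by
      rintro _ ⟨i, rfl⟩ _ ⟨j, rfl⟩
      exact hu i j)
    exact this.is_comm.comm x y
  let _ : CommGroup G := { (inferInstance : Group G) with mul_comm := hG }
  let φ : (J →₀ ℤ) →+ Additive G := Finsupp.liftAddHom fun j =>
    zmultiplesHom (Additive G) (Additive.ofMul ⟨u j, Subgroup.subset_closure ⟨j, rfl⟩⟩)
  let ψ : Multiplicative (J →₀ ℤ) →* Aˣ := G.subtype.comp (AddMonoidHom.toMultiplicativeLeft φ)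
  have hψ : ∀ j, ψ (Multiplicative.ofAdd (Finsupp.single j 1)) = u j := fun j => by
    simp [ψ, φ]
  refine ⟨AddMonoidAlgebra.lift K A _ ((Units.coeHom A).comp ψ), fun j => ?_, fun j => ?_⟩
  · simp [AddMonoidAlgebra.lift_single, hψ]
  · simp [AddMonoidAlgebra.lift_single, hψ]

variable (t : AddMonoidAlgebra K (J →₀ ℤ) →ₐ[K] A)

lemma torus_mul_neg {Γ : Type*} [AddCommGroup Γ] (t : AddMonoidAlgebra K Γ →ₐ[K] A) (γ : Γ) :
    t (Datum.mono K γ) * t (Datum.mono K (-γ)) = 1 := by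
  rw [← map_mul, AddMonoidAlgebra.single_mul_single, add_neg_cancel, mul_one,
    ← AddMonoidAlgebra.one_def, map_one]

lemma torus_add {Γ : Type*} [AddCommGroup Γ] (t : AddMonoidAlgebra K Γ →ₐ[K] A) (γ δ : Γ) :
    t (Datum.mono K (γ + δ)) = t (Datum.mono K γ) * t (Datum.mono K δ) := by
  rw [← map_mul, AddMonoidAlgebra.single_mul_single, mul_one]

lemma torus_zero {Γ : Type*} [AddCommGroup Γ] (t : AddMonoidAlgebra K Γ →ₐ[K] A) :
    t (Datum.mono K (0 : Γ)) = 1 := by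
  rw [Datum.mono, ← AddMonoidAlgebra.one_def, map_one]

lemma torus_range : t.range = Algebra.adjoin K
    (Set.range (fun j => t (Datum.mono K (Finsupp.single j 1))) ∪
      Set.range (fun j => t (Datum.mono K (-Finsupp.single j 1)))) := by
  apply le_antisymm
  · rintro _ ⟨h, rfl⟩
    have key : ∀ γ, t (Datum.mono K γ) ∈ Algebra.adjoin K
        (Set.range (fun j => t (Datum.mono K (Finsupp.single j 1))) ∪
          Set.range (fun j => t (Datum.mono K (-Finsupp.single j 1)))) := by
      intro γ
      induction γ using lattice_induction with
      | h0 => rw [torus_zero]; exact one_mem _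
      | hadd γ δ hγ hδ => rw [torus_add]; exact mul_mem hγ hδ
      | hpos j => exact Algebra.subset_adjoin (.inl ⟨j, rfl⟩)
      | hneg j => exact Algebra.subset_adjoin (.inr ⟨j, rfl⟩)
    change t h ∈ _
    induction h using AddMonoidAlgebra.induction_linear with
    | zero => rw [map_zero]; exact zero_mem _
    | add g h hg hh => rw [map_add]; exact add_mem hg hh
    | single γ c =>
      have : AddMonoidAlgebra.single γ c = c • Datum.mono K γ := by simp
      rw [this, map_smul]
      exact Subalgebra.smul_mem _ (key γ) c
  · rw [Algebra.adjoin_le_iff]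
    rintro _ (⟨j, rfl⟩ | ⟨j, rfl⟩)
    · exact ⟨_, rfl⟩
    · exact ⟨_, rfl⟩

lemma torus_weight {χ : (J →₀ ℤ) → K} (h0 : χ 0 = 1) (hadd : ∀ γ δ, χ (γ + δ) = χ γ * χ δ) {x : A}
    (hx : ∀ j, t (Datum.mono K (Finsupp.single j 1)) * x =
      χ (Finsupp.single j 1) • (x * t (Datum.mono K (Finsupp.single j 1)))) (γ : J →₀ ℤ) :
    t (Datum.mono K γ) * x = χ γ • (x * t (Datum.mono K γ)) := by
  induction γ using lattice_induction with
  | h0 => simp [torus_zero, h0]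
  | hadd γ δ hγ hδ =>
    rw [torus_add, mul_assoc, hδ, mul_smul_comm, ← mul_assoc, hγ, smul_mul_assoc, smul_smul, hadd,
      mul_comm (χ γ), mul_assoc]
  | hpos j => exact hx j
  | hneg j =>
    have h1 : χ (-Finsupp.single j 1) * χ (Finsupp.single j 1) = 1 := by
      rw [← hadd, neg_add_cancel, h0]
    have h2 := torus_mul_neg t (Finsupp.single j 1)
    have h3 := torus_mul_neg t (-Finsupp.single j 1)
    rw [neg_neg] at h3
    -- Multiplying the commutation rule by the inverse on both sides gives the rule for the inverse,
    -- with the reciprocal weight.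
    have h4 := congrArg (fun z => t (Datum.mono K (-Finsupp.single j 1)) * z *
      t (Datum.mono K (-Finsupp.single j 1))) (hx j)
    simp only [mul_smul_comm, smul_mul_assoc, mul_assoc, h2, mul_one] at h4
    rw [← mul_assoc, h3, one_mul] at h4
    rw [h4, smul_smul, h1, one_smul]

/-- Weight data from the weights of the generators of a lattice. -/
def WeightData.ofMatrix {I : Type*} (c : J → I → K) (hc : ∀ j i, c j i ≠ 0) (a b : I → J →₀ ℤ)
    (κ : I → K) : WeightData K I (J →₀ ℤ) where
  χ γ i := γ.prod fun j m => c j i ^ m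
  χ_zero i := Finsupp.prod_zero_index
  χ_add γ δ i := by
    classical
    exact Finsupp.prod_add_index' (fun j => zpow_zero _) fun j m m' => zpow_add₀ (hc j i) m m'
  a := a
  b := b
  κ := κ

section OfMatrix

variable {I : Type*} {c : J → I → K} {hc : ∀ j i, c j i ≠ 0} {a b : I → J →₀ ℤ} {κ : I → K}

@[simp] lemma WeightData.ofMatrix_χ_single (j : J) (i : I) :
    (WeightData.ofMatrix c hc a b κ).χ (Finsupp.single j 1) i = c j i := by
  simp [WeightData.ofMatrix]

@[simp] lemma WeightData.ofMatrix_χ_neg_single (j : J) (i : I) :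
    (WeightData.ofMatrix c hc a b κ).χ (-Finsupp.single j 1) i = (c j i)⁻¹ := by
  rw [← Finsupp.single_neg]
  exact (Finsupp.prod_single_index (zpow_zero _)).trans (zpow_neg_one _)

lemma isRep_ofMatrix [DecidableEq I] {e f : I → A}
    (he : ∀ j i, t (Datum.mono K (Finsupp.single j 1)) * e i =
      c j i • (e i * t (Datum.mono K (Finsupp.single j 1))))
    (hf : ∀ j i, t (Datum.mono K (Finsupp.single j 1)) * f i =
      (c j i)⁻¹ • (f i * t (Datum.mono K (Finsupp.single j 1))))
    (hef : ∀ i j, e i * f j - f j * e i =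
      if i = j then κ i • (t (Datum.mono K (a i)) - t (Datum.mono K (b i))) else 0) :
    IsRep (WeightData.ofMatrix c hc a b κ) e f fun γ => t (Datum.mono K γ) where
  k_zero := torus_zero t
  k_add := torus_add t
  k_e γ i := torus_weight t (χ := fun γ => (WeightData.ofMatrix c hc a b κ).χ γ i)
    (WeightData.χ_zero _ _) (fun _ _ => WeightData.χ_add _ _ _ _)
    (fun j => by rw [WeightData.ofMatrix_χ_single]; exact he j i) γ
  k_f γ i := torus_weight t (χ := fun γ => (WeightData.ofMatrix c hc a b κ).χ (-γ) i)
    (by rw [neg_zero, WeightData.χ_zero])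
    (fun _ _ => by rw [neg_add, WeightData.χ_add])
    (fun j => by rw [WeightData.ofMatrix_χ_neg_single]; exact hf j i) γ
  e_f := hef

end OfMatrix

end Torus

end Triangular

/-! ### The two-parameter quantum group as a presented algebra -/

namespace TwoParam

open Triangular FreeAlgebra

variable {K : Type*} [Field K] {X : ClassicalType} {n : ℕ}

/-- The weights of the `ω i` and the `ω' i`. -/
def pairWeight (X : ClassicalType) (n : ℕ) (r s : K) : Fin n ⊕ Fin n → Fin n → K :=
  Sum.elim (weight X n r s) (weight X n s r)

lemma pairWeight_ne_zero (X : ClassicalType) {r s : K} (hr : r ≠ 0) (hs : s ≠ 0)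
    (j : Fin n ⊕ Fin n) (i : Fin n) : pairWeight X n r s j i ≠ 0 := by
  cases j
  · exact weight_ne_zero X hr hs _ i
  · exact weight_ne_zero X hs hr _ i

/-- The datum of the two-parameter quantum group. -/
def pairDatum (hn : X.minRank ≤ n) {r s : K} (hr : r ≠ 0) (hs : s ≠ 0) :
    Datum K (Fin n) ((Fin n ⊕ Fin n) →₀ ℤ) :=
  serreDatum (WeightData.ofMatrix (pairWeight X n r s) (pairWeight_ne_zero X hr hs)
    (fun i => Finsupp.single (.inl i) 1) (fun i => Finsupp.single (.inr i) 1)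
    fun i => (r ^ rootLen X n i - s ^ rootLen X n i)⁻¹) hn hr hs
    (fun _ _ => WeightData.ofMatrix_χ_neg_single _ _)
    (fun _ _ => WeightData.ofMatrix_χ_neg_single _ _)

section Relators

variable {A : Type*} [Ring A] [Algebra K A] {r s : K}

/-- The Serre relations for a family of elements. -/
structure SerreRelations (X : ClassicalType) (n : ℕ) (r s : K) (e : Fin n → A) : Prop where
  zero (i j : Fin n) (h : cartan X n i j = 0) (hij : ¬ IsFork X n i j)
    (hji : ¬ IsFork X n j i) : e i * e j = e j * e i
  fork (i j : Fin n) (h : IsFork X n i j) : e i * e j = (r * s) • (e j * e i)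
  one (i j : Fin n) (h : cartan X n i j = -1) :
    serreOne (serreParam X n r i j) (serreParam X n s i j) (e i) (e j) = 0
  two (i j : Fin n) (h : cartan X n i j = -2) :
    serreTwo (serreParam X n r i j) (serreParam X n s i j) (e i) (e j) = 0

lemma serreRelations_iff (e : Fin n → A) : SerreRelations X n r s e ↔
    ∀ z, SerreRelator X n r s z → FreeAlgebra.lift K e z = 0 := by
  constructor
  · rintro h z (⟨i, j, h1, h2, h3⟩ | ⟨i, j, h1⟩ | ⟨i, j, h1⟩ | ⟨i, j, h1⟩)
    · simp [h.zero i j h1 h2 h3]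
    · simp [h.fork i j h1]
    · simp only [map_serreOne, lift_ι_apply, h.one i j h1]
    · simp only [map_serreTwo, lift_ι_apply, h.two i j h1]
  · intro h
    refine ⟨fun i j h1 h2 h3 => ?_, fun i j h1 => ?_, fun i j h1 => ?_, fun i j h1 => ?_⟩
    · simpa [sub_eq_zero] using h _ (.zero i j h1 h2 h3)
    · simpa [sub_eq_zero] using h _ (.fork i j h1)
    · simpa only [map_serreOne, lift_ι_apply] using h _ (.one i j h1)
    · simpa only [map_serreTwo, lift_ι_apply] using h _ (.two i j h1)

/-- The relations imposed on the `f i` are those of the `e i` in the opposite algebra, which is how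
both halves can share one set of relators. -/
lemma serreRelations_op_iff (f : Fin n → A) :
    SerreRelations X n r s (fun i => MulOpposite.op (f i)) ↔
      ∀ z, SerreRelator X n r s z → revLift f z = 0 := by
  rw [serreRelations_iff]
  refine forall₂_congr fun z _ => ?_
  rw [← op_revLift, MulOpposite.op_eq_zero_iff]

end Relators

/-- The exponent of a toral generator. -/
def Gen.exponent : Gen n → (Fin n ⊕ Fin n) →₀ ℤ
  | .e _ => 0
  | .f _ => 0
  | .w i => Finsupp.single (.inl i) 1
  | .wInv i => -Finsupp.single (.inl i) 1
  | .wp i => Finsupp.single (.inr i) 1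
  | .wpInv i => -Finsupp.single (.inr i) 1

section Lift

variable {A : Type*} [Ring A] [Algebra K A]

/-- The values of the generators of the two-parameter quantum group in a model. -/
def genValue (e f : Fin n → A) (t : AddMonoidAlgebra K ((Fin n ⊕ Fin n) →₀ ℤ) →ₐ[K] A) :
    Gen n → A
  | .e i => e i
  | .f i => f i
  | g => t (Datum.mono K g.exponent)

lemma model_conj {I Γ : Type*} [AddCommGroup Γ] [DecidableEq I] {D : Datum K I Γ} {e f : I → A}
    {t : AddMonoidAlgebra K Γ →ₐ[K] A} (M : Model D e f t) (γ : Γ) (i : I) :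
    t (Datum.mono K γ) * e i * t (Datum.mono K (-γ)) = D.χ γ i • e i ∧
      t (Datum.mono K γ) * f i * t (Datum.mono K (-γ)) = D.χ (-γ) i • f i := by
  constructor
  · rw [M.isRep.k_e, smul_mul_assoc, mul_assoc, torus_mul_neg, mul_one]
  · rw [M.isRep.k_f, smul_mul_assoc, mul_assoc, torus_mul_neg, mul_one]

/-- This is the universal property in terms of models. It yields the action on the standard module
and later the specialization map. -/
lemma exists_lift (hn : X.minRank ≤ n) {r s : K} (hr : r ≠ 0) (hs : s ≠ 0) {e f : Fin n → A}
    {t : AddMonoidAlgebra K ((Fin n ⊕ Fin n) →₀ ℤ) →ₐ[K] A}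
    (M : Model (pairDatum (X := X) hn hr hs) e f t) :
    ∃ φ : QGroup X n r s →ₐ[K] A, ∀ g, φ (gen X n r s g) = genValue e f t g := by
  have hE : SerreRelations X n r s e := (serreRelations_iff e).2 M.lift_relator
  have hF := (serreRelations_op_iff (r := r) (s := s) (X := X) f).2 M.revLift_relator
  have hconj : ∀ (j : Fin n ⊕ Fin n) (i : Fin n),
      t (Datum.mono K (Finsupp.single j 1)) * e i * t (Datum.mono K (-Finsupp.single j 1)) =
        pairWeight X n r s j i • e i ∧
      t (Datum.mono K (Finsupp.single j 1)) * f i * t (Datum.mono K (-Finsupp.single j 1)) =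
        (pairWeight X n r s j i)⁻¹ • f i := fun j i => by
    have h1 := model_conj M (Finsupp.single j 1) i
    have h2 : (pairDatum (X := X) hn hr hs).χ (Finsupp.single j 1) i = pairWeight X n r s j i :=
      WeightData.ofMatrix_χ_single (hc := pairWeight_ne_zero X hr hs) _ _
    have h3 : (pairDatum (X := X) hn hr hs).χ (-Finsupp.single j 1) i =
      (pairWeight X n r s j i)⁻¹ := WeightData.ofMatrix_χ_neg_single (hc := pairWeight_ne_zero X hr hs) _ _
    rwa [h2, h3] at h1
  have hrel : ∀ ⦃x y : FreeAlgebra K (Gen n)⦄, Rel X n r s x y →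
      FreeAlgebra.lift K (genValue e f t) x = FreeAlgebra.lift K (genValue e f t) y := by
    intro x y h
    cases h with
    | comm a b ha hb =>
      have key : ∀ a : Gen n, a.IsToral → genValue e f t a = t (Datum.mono K a.exponent) := by
        rintro (_ | _ | _ | _ | _ | _) h <;> first | exact h.elim | rfl
      rw [map_mul, map_mul, lift_ι_apply, lift_ι_apply, key a ha, key b hb, ← map_mul, ← map_mul,
        mul_comm]
    | w_inv i =>
      simp only [map_mul, map_one, lift_ι_apply]
      exact torus_mul_neg t _
    | wp_inv i =>
      simp only [map_mul, map_one, lift_ι_apply]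
      exact torus_mul_neg t _
    | w_e j i =>
      simp only [map_mul, map_smul, lift_ι_apply]
      exact (hconj (.inl j) i).1
    | w_f j i =>
      simp only [map_mul, map_smul, lift_ι_apply]
      exact (hconj (.inl j) i).2
    | wp_e j i =>
      simp only [map_mul, map_smul, lift_ι_apply]
      exact (hconj (.inr j) i).1
    | wp_f j i =>
      simp only [map_mul, map_smul, lift_ι_apply]
      exact (hconj (.inr j) i).2
    | e_f i j =>
      have := M.isRep.e_f i j
      rw [map_sub, map_mul, map_mul, lift_ι_apply, lift_ι_apply,
        apply_ite (FreeAlgebra.lift K (genValue e f t)), map_zero, map_smul, map_sub, lift_ι_apply,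
        lift_ι_apply]
      exact this
    | e_zero i j h hij hji =>
      simp only [map_mul, lift_ι_apply]
      exact hE.zero i j h hij hji
    | f_zero i j h hij hji =>
      simp only [map_mul, lift_ι_apply]
      exact (MulOpposite.op_injective (hF.zero i j h hij hji)).symm
    | e_fork i j h =>
      simp only [map_mul, map_smul, lift_ι_apply]
      exact hE.fork i j h
    | f_fork i j h =>
      simp only [map_mul, map_smul, lift_ι_apply]
      exact MulOpposite.op_injective (hF.fork i j h)
    | e_one i j h a b ha hb =>
      subst ha hb
      rw [map_zero]
      exact (map_serreOne (FreeAlgebra.lift K (genValue e f t)) _ _ _ _).trans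
        (by rw [lift_ι_apply, lift_ι_apply]; exact hE.one i j h)
    | e_two i j h a b ha hb =>
      subst ha hb
      rw [map_zero]
      exact (map_serreTwo (FreeAlgebra.lift K (genValue e f t)) _ _ _ _).trans
        (by rw [lift_ι_apply, lift_ι_apply]; exact hE.two i j h)
    | f_one i j h a b ha hb =>
      subst ha hb
      have := congrArg MulOpposite.unop (hF.one i j h)
      simpa [serreOne, mul_assoc, genValue] using this
    | f_two i j h a b ha hb =>
      subst ha hb
      have := congrArg MulOpposite.unop (hF.two i j h)
      simpa [serreTwo, mul_assoc, genValue] using this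
  exact ⟨RingQuot.liftAlgHom K ⟨FreeAlgebra.lift K (genValue e f t), hrel⟩, fun g => by
    rw [gen, RingQuot.liftAlgHom_mkAlgHom_apply, lift_ι_apply]⟩

end Lift

lemma mkAlgHom_ι (r s : K) (g : Gen n) :
    RingQuot.mkAlgHom K (Rel X n r s) (ι K g) = gen X n r s g := rfl

lemma exists_presented (hn : X.minRank ≤ n) {r s : K} (hr : r ≠ 0) (hs : s ≠ 0) :
    ∃ t : AddMonoidAlgebra K ((Fin n ⊕ Fin n) →₀ ℤ) →ₐ[K] QGroup X n r s,
      Presented (pairDatum (X := X) hn hr hs) (fun i => gen X n r s (.e i))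
        (fun i => gen X n r s (.f i)) t ∧
      torPart X n r s = t.range ∧
      ∀ g : Gen n, g.IsToral → gen X n r s g = t (Datum.mono K g.exponent) := by
  have rel : ∀ {x y}, Rel X n r s x y →
      RingQuot.mkAlgHom K (Rel X n r s) x = RingQuot.mkAlgHom K (Rel X n r s) y :=
    fun h => RingQuot.mkAlgHom_rel K h
  have hcomm : ∀ a b : Gen n, a.IsToral → b.IsToral →
      gen X n r s a * gen X n r s b = gen X n r s b * gen X n r s a := fun a b ha hb => by
    simpa only [map_mul, mkAlgHom_ι] using rel (.comm a b ha hb)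
  have hw : ∀ i, gen X n r s (.w i) * gen X n r s (.wInv i) = 1 := fun i => by
    simpa only [map_mul, map_one, mkAlgHom_ι] using rel (.w_inv i)
  have hwp : ∀ i, gen X n r s (.wp i) * gen X n r s (.wpInv i) = 1 := fun i => by
    simpa only [map_mul, map_one, mkAlgHom_ι] using rel (.wp_inv i)
  let u : Fin n ⊕ Fin n → (QGroup X n r s)ˣ := Sum.elim
    (fun i => ⟨gen X n r s (.w i), gen X n r s (.wInv i), hw i,
      (hcomm (.wInv i) (.w i) trivial trivial).trans (hw i)⟩)
    (fun i => ⟨gen X n r s (.wp i), gen X n r s (.wpInv i), hwp i,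
      (hcomm (.wpInv i) (.wp i) trivial trivial).trans (hwp i)⟩)
  obtain ⟨t, ht, ht'⟩ := exists_torus (K := K) u (by
    rintro (i | i) (j | j) <;> ext <;> exact hcomm _ _ trivial trivial)
  have htor : ∀ g : Gen n, g.IsToral → gen X n r s g = t (Datum.mono K g.exponent) := by
    rintro (i | i | i | i | i | i) h
    · exact h.elim
    · exact h.elim
    · exact (ht (.inl i)).symm
    · exact (ht' (.inl i)).symm
    · exact (ht (.inr i)).symm
    · exact (ht' (.inr i)).symm
  have hrange : torPart X n r s = t.range := by
    rw [torus_range, torPart]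
    congr 1
    ext x
    constructor
    · rintro ⟨(i | i | i | i | i | i), h, rfl⟩
      · exact h.elim
      · exact h.elim
      · exact .inl ⟨.inl i, (htor (.w i) trivial).symm⟩
      · exact .inr ⟨.inl i, (htor (.wInv i) trivial).symm⟩
      · exact .inl ⟨.inr i, (htor (.wp i) trivial).symm⟩
      · exact .inr ⟨.inr i, (htor (.wpInv i) trivial).symm⟩
    · rintro (⟨i | i, rfl⟩ | ⟨i | i, rfl⟩)
      · exact ⟨.w i, trivial, (htor (.w i) trivial).symm⟩
      · exact ⟨.wp i, trivial, (htor (.wp i) trivial).symm⟩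
      · exact ⟨.wInv i, trivial, (htor (.wInv i) trivial).symm⟩
      · exact ⟨.wpInv i, trivial, (htor (.wpInv i) trivial).symm⟩
  have hmul : ∀ (j : Fin n ⊕ Fin n) (x : QGroup X n r s) (c : K),
      t (Datum.mono K (Finsupp.single j 1)) * x * t (Datum.mono K (-Finsupp.single j 1)) = c • x →
      t (Datum.mono K (Finsupp.single j 1)) * x =
        c • (x * t (Datum.mono K (Finsupp.single j 1))) := fun j x c h => by
    have h3 := torus_mul_neg t (-Finsupp.single j 1)
    rw [neg_neg] at h3
    rw [← smul_mul_assoc, ← h, mul_assoc _ _ (t (Datum.mono K (Finsupp.single j 1))), h3, mul_one]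
  refine ⟨t, { isRep := ?_, lift_relator := ?_, revLift_relator := ?_, generated := ?_, acts := ?_ },
    hrange, htor⟩
  · refine isRep_ofMatrix (hc := pairWeight_ne_zero X hr hs) t ?_ ?_ ?_
    · rintro (j | j) i <;> apply hmul <;> rw [ht, ht']
      · have h := rel (.w_e j i)
        simp only [map_mul, map_smul, mkAlgHom_ι] at h
        exact h
      · have h := rel (.wp_e j i)
        simp only [map_mul, map_smul, mkAlgHom_ι] at h
        exact h
    · rintro (j | j) i <;> apply hmul <;> rw [ht, ht']
      · have h := rel (.w_f j i)
        simp only [map_mul, map_smul, mkAlgHom_ι] at h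
        exact h
      · have h := rel (.wp_f j i)
        simp only [map_mul, map_smul, mkAlgHom_ι] at h
        exact h
    · intro i j
      have := rel (.e_f i j)
      rw [map_sub, map_mul, map_mul, apply_ite (RingQuot.mkAlgHom K (Rel X n r s)), map_zero,
        map_smul, map_sub] at this
      rw [ht, ht]
      exact this
  · refine (serreRelations_iff _).1 ⟨fun i j h1 h2 h3 => ?_, fun i j h1 => ?_, fun i j h1 => ?_,
      fun i j h1 => ?_⟩
    · simpa only [map_mul, mkAlgHom_ι] using rel (.e_zero i j h1 h2 h3)
    · simpa only [map_mul, map_smul, mkAlgHom_ι] using rel (.e_fork i j h1)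
    · have := rel (.e_one i j h1 _ _ rfl rfl)
      rw [map_zero] at this
      exact (map_serreOne (RingQuot.mkAlgHom K (Rel X n r s)) _ _ _ _).symm.trans this
    · have := rel (.e_two i j h1 _ _ rfl rfl)
      rw [map_zero] at this
      exact (map_serreTwo (RingQuot.mkAlgHom K (Rel X n r s)) _ _ _ _).symm.trans this
  · refine (serreRelations_op_iff _).1 ⟨fun i j h1 h2 h3 => ?_, fun i j h1 => ?_,
      fun i j h1 => ?_, fun i j h1 => ?_⟩ <;> apply MulOpposite.unop_injective
    · simpa only [map_mul, mkAlgHom_ι, MulOpposite.unop_mul, MulOpposite.unop_op]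
        using (rel (.f_zero i j h1 h2 h3)).symm
    · simpa only [map_mul, map_smul, mkAlgHom_ι, MulOpposite.unop_mul, MulOpposite.unop_op,
        MulOpposite.unop_smul] using rel (.f_fork i j h1)
    · have := rel (.f_one i j h1 _ _ rfl rfl)
      simp only [map_add, map_sub, map_smul, map_mul, map_pow, map_zero, mkAlgHom_ι] at this
      simpa [serreOne, mul_assoc] using this
    · have := rel (.f_two i j h1 _ _ rfl rfl)
      simp only [map_add, map_sub, map_smul, map_mul, map_pow, map_zero, mkAlgHom_ι] at this
      simpa [serreTwo, mul_assoc] using this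
  · rw [eq_top_iff]
    rintro x -
    obtain ⟨x, rfl⟩ := RingQuot.mkAlgHom_surjective K (Rel X n r s) x
    induction x using FreeAlgebra.induction with
    | grade0 c => rw [AlgHom.commutes]; exact Subalgebra.algebraMap_mem _ c
    | grade1 g =>
      apply Algebra.subset_adjoin
      by_cases hg : g.IsToral
      · exact .inr ⟨_, (htor g hg).symm⟩
      · cases g with
        | e i => exact .inl (.inl ⟨i, rfl⟩)
        | f i => exact .inl (.inr ⟨i, rfl⟩)
        | _ => exact absurd trivial hg
    | mul x y hx hy => rw [map_mul]; exact mul_mem hx hy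
    | add x y hx hy => rw [map_add]; exact add_mem hx hy
  -- The operators on the standard module form a model, so the universal property supplies the
  -- action. Agreement on the whole torus follows from agreement on the generators of the lattice
  -- and their inverses.
  · obtain ⟨ρ, hρ⟩ := exists_lift hn hr hs (pairDatum (X := X) hn hr hs).model_op
    refine ⟨ρ, fun i => hρ _, fun i => hρ _, fun γ => ?_⟩
    rw [← Datum.opTor_mono]
    induction γ using lattice_induction with
    | h0 => rw [torus_zero, torus_zero, map_one]
    | hadd γ δ hγ hδ => rw [torus_add, torus_add, map_mul, hγ, hδ]
    | hpos j =>
      cases j with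
      | inl j => exact (congrArg ρ (htor (.w j) trivial)).symm.trans (hρ (.w j))
      | inr j => exact (congrArg ρ (htor (.wp j) trivial)).symm.trans (hρ (.wp j))
    | hneg j =>
      cases j with
      | inl j => exact (congrArg ρ (htor (.wInv j) trivial)).symm.trans (hρ (.wInv j))
      | inr j => exact (congrArg ρ (htor (.wpInv j) trivial)).symm.trans (hρ (.wpInv j))

end TwoParam

/-! ### The Drinfeld–Jimbo quantum group as a presented algebra -/

namespace TwoParam

open Triangular FreeAlgebra

variable {K : Type*} [Field K] {X : ClassicalType} {n : ℕ}

/-- With `r s = 1` the asymmetry between smaller and larger indices disappears, and the fork weights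
become `1`, in agreement with a Cartan integer `0`. -/
lemma weight_inv (hn : X.minRank ≤ n) {q : K} (hq : q ≠ 0) (i j : Fin n) :
    weight X n q q⁻¹ i j = (q ^ rootLen X n i) ^ cartan X n i j := by
  by_cases hij : IsFork X n i j
  · rw [(hij.weight q q⁻¹).1, (hij.cartan hn).1, mul_inv_cancel₀ hq, zpow_zero]
  by_cases hji : IsFork X n j i
  · rw [(hji.weight q q⁻¹).2, (hji.cartan hn).2, mul_inv_cancel₀ hq, zpow_zero, inv_one]
  rcases lt_trichotomy i j with h | rfl | h
  · rw [weight_of_lt hn _ _ h hij, inv_zpow, ← zpow_neg, neg_neg, zpow_mul]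
  · rw [weight_self hn, cartan_self hn, inv_zpow, inv_inv, zpow_two]
  · rw [weight_of_gt hn _ _ h hji, ← rootLen_mul_cartan hn h, zpow_mul]

/-- This makes `ω' i` act as the inverse of `ω i`, hence compatible with the identification `ω' i =
(K i)⁻¹`. -/
lemma weight_inv_swap (hn : X.minRank ≤ n) {q : K} (hq : q ≠ 0) (i j : Fin n) :
    weight X n q⁻¹ q i j = (weight X n q q⁻¹ i j)⁻¹ := by
  have := weight_inv hn (inv_ne_zero hq) i j
  rw [inv_inv] at this
  rw [this, weight_inv hn hq, inv_zpow, inv_zpow]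

/-- The datum of the Drinfeld–Jimbo quantum group. -/
def djDatum (hn : X.minRank ≤ n) {q : K} (hq : q ≠ 0) : Datum K (Fin n) (Fin n →₀ ℤ) :=
  serreDatum (WeightData.ofMatrix (weight X n q q⁻¹) (weight_ne_zero X hq (inv_ne_zero hq))
    (fun i => Finsupp.single i 1) (fun i => -Finsupp.single i 1)
    fun i => (q ^ rootLen X n i - (q ^ rootLen X n i)⁻¹)⁻¹) hn hq (inv_ne_zero hq)
    (fun _ _ => WeightData.ofMatrix_χ_neg_single _ _)
    -- Here `b i` is the negative of a basis vector, so the sign cancels and the weight of `K i`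
    -- itself has to be compared with that of `ω' i`.
    (fun i j => by
      change WeightData.χ _ (- -Finsupp.single i 1) j = _
      rw [neg_neg, WeightData.ofMatrix_χ_single, weight_inv_swap hn hq, inv_inv])

section SerreSum

variable {A : Type*} [Ring A] [Algebra K A]

lemma serreSum_zero (q : K) (x y : A) : serreSum q 0 x y = x * y - y * x := by
  simp [serreSum, Finset.sum_range_succ, qBinom, sub_eq_add_neg]

lemma serreSum_neg_one {q : K} (hq : q ≠ 0) (x y : A) :
    serreSum q (-1) x y = serreOne q q⁻¹ x y := by
  have h : ((1 : ℤ) - -1).toNat = 2 := rfl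
  simp only [serreSum, h, Finset.sum_range_succ, Finset.sum_range_zero, qBinom, serreOne]
  simp only [pow_zero, pow_one, mul_one, one_mul, zero_add, Nat.sub_zero, Nat.sub_self]
  norm_num [mul_inv_cancel₀ hq]
  module

lemma serreSum_neg_two {q : K} (hq : q ≠ 0) (x y : A) :
    serreSum q (-2) x y = serreTwo q q⁻¹ x y := by
  have h : ((1 : ℤ) - -2).toNat = 3 := rfl
  simp only [serreSum, h, Finset.sum_range_succ, Finset.sum_range_zero, qBinom, serreTwo]
  simp only [pow_zero, pow_one, mul_one, one_mul, zero_add, Nat.sub_zero, Nat.sub_self]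
  norm_num [mul_inv_cancel₀ hq]
  match_scalars <;> field_simp <;> ring

/-- At `s = q⁻¹` inverting both parameters merely exchanges them, so by symmetry the order of the
vertices ceases to matter. -/
lemma serreParam_cases (X : ClassicalType) (q : K) (i j : Fin n) :
    serreParam X n q i j = q ^ rootLen X n i ∧ serreParam X n q⁻¹ i j = (q ^ rootLen X n i)⁻¹ ∨
      serreParam X n q i j = (q ^ rootLen X n i)⁻¹ ∧ serreParam X n q⁻¹ i j = q ^ rootLen X n i := by
  by_cases h : i < j
  · left; simp [serreParam, h]
  · right; simp [serreParam, h]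

lemma serreRelations_inv_iff (hn : X.minRank ≤ n) {q : K} (hq : q ≠ 0) (e : Fin n → A) :
    SerreRelations X n q q⁻¹ e ↔ ∀ i j, i ≠ j →
      serreSum (q ^ rootLen X n i) (cartan X n i j) (e i) (e j) = 0 := by
  have hq' : ∀ i, q ^ rootLen X n i ≠ 0 := fun i => zpow_ne_zero _ hq
  have h1 : ∀ i j, cartan X n i j = -1 →
      serreSum (q ^ rootLen X n i) (cartan X n i j) (e i) (e j) =
      serreOne (serreParam X n q i j) (serreParam X n q⁻¹ i j) (e i) (e j) := fun i j h => by
    rw [h, serreSum_neg_one (hq' i)]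
    rcases serreParam_cases X q i j with ⟨ha, hb⟩ | ⟨ha, hb⟩ <;> rw [ha, hb]
    exact serreOne_comm _ _ _ _
  have h2 : ∀ i j, cartan X n i j = -2 →
      serreSum (q ^ rootLen X n i) (cartan X n i j) (e i) (e j) =
      serreTwo (serreParam X n q i j) (serreParam X n q⁻¹ i j) (e i) (e j) := fun i j h => by
    rw [h, serreSum_neg_two (hq' i)]
    rcases serreParam_cases X q i j with ⟨ha, hb⟩ | ⟨ha, hb⟩ <;> rw [ha, hb]
    exact serreTwo_comm _ _ _ _
  constructor
  · intro H i j hij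
    rcases cartan_cases hn hij with h | h | h
    · rw [h, serreSum_zero, sub_eq_zero]
      by_cases hf : IsFork X n i j
      · have := H.fork i j hf
        rwa [mul_inv_cancel₀ hq, one_smul] at this
      by_cases hf' : IsFork X n j i
      · have := H.fork j i hf'
        rw [mul_inv_cancel₀ hq, one_smul] at this
        exact this.symm
      exact H.zero i j h hf hf'
    · rw [h1 i j h]; exact H.one i j h
    · rw [h2 i j h]; exact H.two i j h
  · intro H
    have hne : ∀ {i j}, cartan X n i j ≠ 2 → i ≠ j := ne_of_cartan hn
    refine ⟨fun i j h _ _ => ?_, fun i j h => ?_, fun i j h => ?_, fun i j h => ?_⟩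
    · have := H i j (hne (by omega))
      rwa [h, serreSum_zero, sub_eq_zero] at this
    · have := H i j h.lt.ne
      rw [(h.cartan hn).1, serreSum_zero, sub_eq_zero] at this
      rw [mul_inv_cancel₀ hq, one_smul, this]
    · rw [← h1 i j h]; exact H i j (hne (by omega))
    · rw [← h2 i j h]; exact H i j (hne (by omega))

/-- The Drinfeld–Jimbo relations for the `F i` are not read backwards, whereas those of a datum are.
The Gaussian binomials are palindromic, so reversal changes a Serre sum only by the sign `(-1) ^ (1
- a)`. -/
lemma serreSum_op_eq_zero_iff (hn : X.minRank ≤ n) {q : K} (hq : q ≠ 0) (f : Fin n → A)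
    {i j : Fin n} (hij : i ≠ j) :
    serreSum (q ^ rootLen X n i) (cartan X n i j) (MulOpposite.op (f i)) (MulOpposite.op (f j)) = 0 ↔
      serreSum (q ^ rootLen X n i) (cartan X n i j) (f i) (f j) = 0 := by
  have hq' : q ^ rootLen X n i ≠ 0 := zpow_ne_zero _ hq
  have hc := mul_inv_cancel₀ hq'
  rcases cartan_cases hn hij with h | h | h <;> rw [h]
  · rw [serreSum_zero, serreSum_zero, sub_eq_zero, sub_eq_zero, ← MulOpposite.op_mul,
      ← MulOpposite.op_mul, MulOpposite.op_inj, eq_comm]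
  · have : serreOne (q ^ rootLen X n i) (q ^ rootLen X n i)⁻¹ (MulOpposite.op (f i))
        (MulOpposite.op (f j)) = MulOpposite.op
          (serreOne (q ^ rootLen X n i) (q ^ rootLen X n i)⁻¹ (f i) (f j)) := by
      apply MulOpposite.unop_injective
      simp only [serreOne, hc, MulOpposite.unop_add, MulOpposite.unop_sub, MulOpposite.unop_smul,
        MulOpposite.unop_mul, MulOpposite.unop_pow, MulOpposite.unop_op, one_smul, mul_assoc]
      abel
    rw [serreSum_neg_one hq', serreSum_neg_one hq', this, MulOpposite.op_eq_zero_iff]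
  · have : serreTwo (q ^ rootLen X n i) (q ^ rootLen X n i)⁻¹ (MulOpposite.op (f i))
        (MulOpposite.op (f j)) = -MulOpposite.op
          (serreTwo (q ^ rootLen X n i) (q ^ rootLen X n i)⁻¹ (f i) (f j)) := by
      apply MulOpposite.unop_injective
      simp only [serreTwo, hc, MulOpposite.unop_add, MulOpposite.unop_sub, MulOpposite.unop_smul,
        MulOpposite.unop_mul, MulOpposite.unop_pow, MulOpposite.unop_op, one_pow, one_mul, one_smul,
        MulOpposite.unop_neg, mul_assoc]
      abel
    rw [serreSum_neg_two hq', serreSum_neg_two hq', this, neg_eq_zero, MulOpposite.op_eq_zero_iff]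

lemma serreRelations_op_inv_iff (hn : X.minRank ≤ n) {q : K} (hq : q ≠ 0) (f : Fin n → A) :
    SerreRelations X n q q⁻¹ (fun i => MulOpposite.op (f i)) ↔ ∀ i j, i ≠ j →
      serreSum (q ^ rootLen X n i) (cartan X n i j) (f i) (f j) = 0 := by
  rw [serreRelations_inv_iff hn hq]
  exact forall₃_congr fun i j hij => serreSum_op_eq_zero_iff hn hq f hij

lemma map_serreSum {B : Type*} [Ring B] [Algebra K B] (φ : A →ₐ[K] B) (q : K) (a : ℤ) (x y : A) :
    φ (serreSum q a x y) = serreSum q a (φ x) (φ y) := by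
  simp [serreSum]

end SerreSum

section Lift

variable {A : Type*} [Ring A] [Algebra K A]

/-- The values of the generators of the Drinfeld–Jimbo quantum group in a model. -/
def djValue (e f : Fin n → A) (t : AddMonoidAlgebra K (Fin n →₀ ℤ) →ₐ[K] A) : DJGen n → A
  | .e i => e i
  | .f i => f i
  | .k i => t (Datum.mono K (Finsupp.single i 1))
  | .kInv i => t (Datum.mono K (-Finsupp.single i 1))

lemma exists_djLift (hn : X.minRank ≤ n) {q : K} (hq : q ≠ 0) {e f : Fin n → A}
    {t : AddMonoidAlgebra K (Fin n →₀ ℤ) →ₐ[K] A} (M : Model (djDatum (X := X) hn hq) e f t) :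
    ∃ φ : DJGroup X n q →ₐ[K] A, ∀ g, φ (djGen X n q g) = djValue e f t g := by
  have hE := (serreRelations_inv_iff hn hq e).1 ((serreRelations_iff e).2 M.lift_relator)
  have hF := (serreRelations_op_inv_iff hn hq f).1 ((serreRelations_op_iff f).2 M.revLift_relator)
  have hconj : ∀ j i : Fin n,
      t (Datum.mono K (Finsupp.single j 1)) * e i * t (Datum.mono K (-Finsupp.single j 1)) =
        (q ^ rootLen X n j) ^ cartan X n j i • e i ∧
      t (Datum.mono K (Finsupp.single j 1)) * f i * t (Datum.mono K (-Finsupp.single j 1)) =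
        (q ^ rootLen X n j) ^ (-cartan X n j i) • f i := fun j i => by
    have h1 := model_conj M (Finsupp.single j 1) i
    have h2 : (djDatum (X := X) hn hq).χ (Finsupp.single j 1) i = weight X n q q⁻¹ j i :=
      WeightData.ofMatrix_χ_single (hc := weight_ne_zero X hq (inv_ne_zero hq)) _ _
    have h3 : (djDatum (X := X) hn hq).χ (-Finsupp.single j 1) i = (weight X n q q⁻¹ j i)⁻¹ :=
      WeightData.ofMatrix_χ_neg_single (hc := weight_ne_zero X hq (inv_ne_zero hq)) _ _
    rwa [h2, h3, weight_inv hn hq, ← zpow_neg] at h1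
  have hrel : ∀ ⦃x y : FreeAlgebra K (DJGen n)⦄, DJRel X n q x y →
      FreeAlgebra.lift K (djValue e f t) x = FreeAlgebra.lift K (djValue e f t) y := by
    intro x y h
    cases h with
    | comm i j =>
      simp only [map_mul, lift_ι_apply, djValue]
      rw [← map_mul, ← map_mul, mul_comm]
    | k_inv i =>
      simp only [map_mul, map_one, lift_ι_apply]
      exact torus_mul_neg t _
    | inv_k i =>
      simp only [map_mul, map_one, lift_ι_apply]
      have := torus_mul_neg t (-Finsupp.single i 1)
      rwa [neg_neg] at this
    | k_e i j =>
      simp only [map_mul, map_smul, lift_ι_apply]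
      exact (hconj i j).1
    | k_f i j =>
      simp only [map_mul, map_smul, lift_ι_apply]
      exact (hconj i j).2
    | e_f i j =>
      have := M.isRep.e_f i j
      rw [map_sub, map_mul, map_mul, lift_ι_apply, lift_ι_apply,
        apply_ite (FreeAlgebra.lift K (djValue e f t)), map_zero, map_smul, map_sub, lift_ι_apply,
        lift_ι_apply]
      exact this
    | serre_e i j h =>
      rw [map_zero, map_serreSum, lift_ι_apply, lift_ι_apply]
      exact hE i j h
    | serre_f i j h =>
      rw [map_zero, map_serreSum, lift_ι_apply, lift_ι_apply]
      exact hF i j h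
  exact ⟨RingQuot.liftAlgHom K ⟨FreeAlgebra.lift K (djValue e f t), hrel⟩, fun g => by
    rw [djGen, RingQuot.liftAlgHom_mkAlgHom_apply, lift_ι_apply]⟩

end Lift

lemma mkAlgHom_djGen (q : K) (g : DJGen n) :
    RingQuot.mkAlgHom K (DJRel X n q) (ι K g) = djGen X n q g := rfl

lemma exists_djPresented (hn : X.minRank ≤ n) {q : K} (hq : q ≠ 0) :
    ∃ t : AddMonoidAlgebra K (Fin n →₀ ℤ) →ₐ[K] DJGroup X n q,
      Presented (djDatum (X := X) hn hq) (fun i => djGen X n q (.e i))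
        (fun i => djGen X n q (.f i)) t ∧
      djTorPart X n q = t.range ∧
      (∀ i, t (Datum.mono K (Finsupp.single i 1)) = djGen X n q (.k i)) ∧
      ∀ i, t (Datum.mono K (-Finsupp.single i 1)) = djGen X n q (.kInv i) := by
  have rel : ∀ {x y}, DJRel X n q x y →
      RingQuot.mkAlgHom K (DJRel X n q) x = RingQuot.mkAlgHom K (DJRel X n q) y :=
    fun h => RingQuot.mkAlgHom_rel K h
  let u : Fin n → (DJGroup X n q)ˣ := fun i => ⟨djGen X n q (.k i), djGen X n q (.kInv i),
    by simpa only [map_mul, map_one, mkAlgHom_djGen] using rel (.k_inv i),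
    by simpa only [map_mul, map_one, mkAlgHom_djGen] using rel (.inv_k i)⟩
  obtain ⟨t, ht, ht'⟩ := exists_torus (K := K) u fun i j => Units.ext <| by
    have h := rel (.comm i j)
    simp only [map_mul, mkAlgHom_djGen] at h
    exact h
  have hk : ∀ i, t (Datum.mono K (Finsupp.single i 1)) = djGen X n q (.k i) := ht
  have hk' : ∀ i, t (Datum.mono K (-Finsupp.single i 1)) = djGen X n q (.kInv i) := ht'
  have hrange : djTorPart X n q = t.range := by
    rw [torus_range, djTorPart]
    simp only [hk, hk']
  have hmul : ∀ (j : Fin n) (x : DJGroup X n q) (c : K),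
      djGen X n q (.k j) * x * djGen X n q (.kInv j) = c • x →
      djGen X n q (.k j) * x = c • (x * djGen X n q (.k j)) := fun j x c h => by
    have h3 : djGen X n q (.kInv j) * djGen X n q (.k j) = 1 := (u j).inv_mul
    rw [← smul_mul_assoc, ← h, mul_assoc _ _ (djGen X n q (.k j)), h3, mul_one]
  refine ⟨t, { isRep := ?_, lift_relator := ?_, revLift_relator := ?_, generated := ?_, acts := ?_ },
    hrange, hk, hk'⟩
  · refine isRep_ofMatrix (hc := weight_ne_zero X hq (inv_ne_zero hq)) t ?_ ?_ ?_
    · intro j i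
      rw [hk, weight_inv hn hq]
      apply hmul
      simpa only [map_mul, map_smul, mkAlgHom_djGen] using rel (.k_e j i)
    · intro j i
      rw [hk, weight_inv hn hq, ← zpow_neg]
      apply hmul
      simpa only [map_mul, map_smul, mkAlgHom_djGen] using rel (.k_f j i)
    · intro i j
      have := rel (.e_f i j)
      rw [map_sub, map_mul, map_mul, apply_ite (RingQuot.mkAlgHom K (DJRel X n q)), map_zero,
        map_smul, map_sub] at this
      rw [hk, hk']
      exact this
  · refine (serreRelations_iff _).1 ((serreRelations_inv_iff hn hq _).2 fun i j hij => ?_)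
    have := rel (.serre_e i j hij)
    rwa [map_zero, map_serreSum] at this
  · refine (serreRelations_op_iff _).1 ((serreRelations_op_inv_iff hn hq _).2 fun i j hij => ?_)
    have := rel (.serre_f i j hij)
    rwa [map_zero, map_serreSum] at this
  · rw [eq_top_iff]
    rintro x -
    obtain ⟨x, rfl⟩ := RingQuot.mkAlgHom_surjective K (DJRel X n q) x
    induction x using FreeAlgebra.induction with
    | grade0 c => rw [AlgHom.commutes]; exact Subalgebra.algebraMap_mem _ c
    | grade1 g =>
      apply Algebra.subset_adjoin
      cases g with
      | e i => exact .inl (.inl ⟨i, rfl⟩)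
      | f i => exact .inl (.inr ⟨i, rfl⟩)
      | k i => exact .inr ⟨_, hk i⟩
      | kInv i => exact .inr ⟨_, hk' i⟩
    | mul x y hx hy => rw [map_mul]; exact mul_mem hx hy
    | add x y hx hy => rw [map_add]; exact add_mem hx hy
  · obtain ⟨ρ, hρ⟩ := exists_djLift hn hq (djDatum (X := X) hn hq).model_op
    refine ⟨ρ, fun i => hρ _, fun i => hρ _, fun γ => ?_⟩
    rw [← Datum.opTor_mono]
    induction γ using lattice_induction with
    | h0 => rw [torus_zero, torus_zero, map_one]
    | hadd γ δ hγ hδ => rw [torus_add, torus_add, map_mul, hγ, hδ]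
    | hpos j => rw [hk]; exact hρ (.k j)
    | hneg j => rw [hk']; exact hρ (.kInv j)

end TwoParam

/-! ### Specialization at `r = q`, `s = q⁻¹` -/

namespace TwoParam

open Triangular FreeAlgebra

variable {K : Type*} [Field K] {X : ClassicalType} {n : ℕ} {A : Type*} [Ring A] [Algebra K A]

lemma model_map {I Γ B : Type*} [AddCommGroup Γ] [DecidableEq I] [Ring B] [Algebra K B]
    {D : Datum K I Γ} {e f : I → A} {t : AddMonoidAlgebra K Γ →ₐ[K] A} (M : Model D e f t)
    (φ : A →ₐ[K] B) : Model D (fun i => φ (e i)) (fun i => φ (f i)) (φ.comp t) where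
  isRep :=
    { k_zero := torus_zero _
      k_add := torus_add _
      k_e γ i := by simpa using congrArg φ (M.isRep.k_e γ i)
      k_f γ i := by simpa using congrArg φ (M.isRep.k_f γ i)
      e_f i j := by
        have := congrArg φ (M.isRep.e_f i j)
        rw [apply_ite φ] at this
        simpa only [map_sub, map_mul, map_smul, map_zero, AlgHom.comp_apply] using this }
  lift_relator s hs := by
    have h : φ.comp (FreeAlgebra.lift K e) = FreeAlgebra.lift K fun i => φ (e i) := by
      ext i; simp
    rw [← h, AlgHom.comp_apply, M.lift_relator s hs, map_zero]
  revLift_relator s hs := by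
    have h : ∀ z : FreeAlgebra K I, φ (revLift f z) = revLift (fun i => φ (f i)) z := fun z => by
      induction z using FreeAlgebra.induction with
      | grade0 r => simp
      | grade1 i => simp
      | mul x y hx hy => simp [hx, hy]
      | add x y hx hy => simp [hx, hy]
    rw [← h, M.revLift_relator s hs, map_zero]

/-- The unit of a monomial of the torus. -/
def torusUnit {Γ : Type*} [AddCommGroup Γ] (t : AddMonoidAlgebra K Γ →ₐ[K] A) (γ : Γ) : Aˣ where
  val := t (Datum.mono K γ)
  inv := t (Datum.mono K (-γ))
  val_inv := torus_mul_neg t γ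
  inv_val := by simpa only [neg_neg] using torus_mul_neg t (-γ)

lemma torusUnit_comm {Γ : Type*} [AddCommGroup Γ] (t : AddMonoidAlgebra K Γ →ₐ[K] A) (γ δ : Γ) :
    torusUnit t γ * torusUnit t δ = torusUnit t δ * torusUnit t γ := by
  ext
  change t _ * t _ = t _ * t _
  rw [← map_mul, ← map_mul, mul_comm]

/-- The rank `2n` torus is made to act through the rank `n` one by `ω i ↦ K i`, `ω' i ↦ (K i)⁻¹`.
Applied to `U_q(g)` itself, this gives the specialization map. -/
lemma exists_pairModel (hn : X.minRank ≤ n) {q : K} (hq : q ≠ 0) {e f : Fin n → A}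
    {t : AddMonoidAlgebra K (Fin n →₀ ℤ) →ₐ[K] A} (M : Model (djDatum (X := X) hn hq) e f t) :
    ∃ t', Model (pairDatum (X := X) hn hq (inv_ne_zero hq)) e f t' ∧
      (∀ i, t' (Datum.mono K (Finsupp.single (.inl i) 1)) = t (Datum.mono K (Finsupp.single i 1))) ∧
      (∀ i, t' (Datum.mono K (Finsupp.single (.inr i) 1)) =
        t (Datum.mono K (-Finsupp.single i 1))) ∧
      ∀ i, t' (Datum.mono K (-Finsupp.single (.inl i) 1)) =
        t (Datum.mono K (-Finsupp.single i 1)) := by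
  have hq' := inv_ne_zero hq
  obtain ⟨t', ht, ht'⟩ := exists_torus (K := K) (J := Fin n ⊕ Fin n)
    (fun j => torusUnit t (Sum.elim (fun i => Finsupp.single i 1) (fun i => -Finsupp.single i 1) j))
    fun i j => torusUnit_comm t _ _
  have hl : ∀ i, t' (Datum.mono K (Finsupp.single (.inl i) 1)) =
    t (Datum.mono K (Finsupp.single i 1)) := fun i => ht (.inl i)
  have hr : ∀ i, t' (Datum.mono K (Finsupp.single (.inr i) 1)) =
    t (Datum.mono K (-Finsupp.single i 1)) := fun i => ht (.inr i)
  have h1 : ∀ i j, (djDatum (X := X) hn hq).χ (Finsupp.single j 1) i = weight X n q q⁻¹ j i :=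
    fun i j => WeightData.ofMatrix_χ_single (hc := weight_ne_zero X hq hq') _ _
  have h2 : ∀ i j, (djDatum (X := X) hn hq).χ (-Finsupp.single j 1) i = weight X n q⁻¹ q j i :=
    fun i j => (WeightData.ofMatrix_χ_neg_single (hc := weight_ne_zero X hq hq') _ _).trans
      (weight_inv_swap hn hq j i).symm
  refine ⟨t', ⟨isRep_ofMatrix (hc := pairWeight_ne_zero X hq hq') t' ?_ ?_ ?_,
    M.lift_relator, M.revLift_relator⟩, hl, hr, fun i => ht' (.inl i)⟩
  · rintro (j | j) i
    · rw [hl, M.isRep.k_e, h1]; rfl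
    · rw [hr, M.isRep.k_e, h2]; rfl
  · rintro (j | j) i
    · rw [hl, M.isRep.k_f, h2, weight_inv_swap hn hq]; rfl
    · rw [hr, M.isRep.k_f, neg_neg, h1, ← inv_inv (weight X n q q⁻¹ j i), ← weight_inv_swap hn hq]
      rfl
  · intro i j
    rw [hl, hr, inv_zpow]
    exact M.isRep.e_f i j

/-- A converse to `exists_pairModel`: once `ω' i = (ω i)⁻¹` holds, the torus of rank `n` generated
by the `ω i` suffices. It is applied to the quotient by the ideal that enforces this equation. -/
lemma exists_djModel (hn : X.minRank ≤ n) {q : K} (hq : q ≠ 0) {e f : Fin n → A}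
    {t : AddMonoidAlgebra K ((Fin n ⊕ Fin n) →₀ ℤ) →ₐ[K] A}
    (M : Model (pairDatum (X := X) hn hq (inv_ne_zero hq)) e f t)
    (h : ∀ i, t (Datum.mono K (Finsupp.single (.inr i) 1)) =
      t (Datum.mono K (-Finsupp.single (.inl i) 1))) :
    ∃ t', Model (djDatum (X := X) hn hq) e f t' ∧
      (∀ i, t' (Datum.mono K (Finsupp.single i 1)) = t (Datum.mono K (Finsupp.single (.inl i) 1))) ∧
      ∀ i, t' (Datum.mono K (-Finsupp.single i 1)) =
        t (Datum.mono K (-Finsupp.single (.inl i) 1)) := by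
  have hq' := inv_ne_zero hq
  obtain ⟨t', ht, ht'⟩ := exists_torus (K := K)
    (fun i : Fin n => torusUnit t (Finsupp.single (.inl i) 1)) fun i j => torusUnit_comm t _ _
  have hl : ∀ i, t' (Datum.mono K (Finsupp.single i 1)) =
    t (Datum.mono K (Finsupp.single (.inl i) 1)) := ht
  have hl' : ∀ i, t' (Datum.mono K (-Finsupp.single i 1)) =
    t (Datum.mono K (-Finsupp.single (.inl i) 1)) := ht'
  have h1 : ∀ i j, (pairDatum (X := X) hn hq hq').χ (Finsupp.single (.inl j) 1) i =
      weight X n q q⁻¹ j i :=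
    fun i j => WeightData.ofMatrix_χ_single (hc := pairWeight_ne_zero X hq hq') _ _
  have h2 : ∀ i j, (pairDatum (X := X) hn hq hq').χ (-Finsupp.single (.inl j) 1) i =
      (weight X n q q⁻¹ j i)⁻¹ :=
    fun i j => WeightData.ofMatrix_χ_neg_single (hc := pairWeight_ne_zero X hq hq') _ _
  refine ⟨t', ⟨isRep_ofMatrix (hc := weight_ne_zero X hq hq') t' ?_ ?_ ?_,
    M.lift_relator, M.revLift_relator⟩, hl, hl'⟩
  · intro j i
    rw [hl, M.isRep.k_e, h1]
  · intro j i
    rw [hl, M.isRep.k_f, h2]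
  · intro i j
    rw [hl, hl', ← h, ← inv_zpow]
    exact M.isRep.e_f i j

/-- The specialization of the two-parameter quantum group at `r = q`, `s = q⁻¹`. -/
theorem exists_specialization (hn : X.minRank ≤ n) {q : K} (hq : q ≠ 0) :
    ∃ π : QGroup X n q q⁻¹ →ₐ[K] DJGroup X n q,
      (∀ i : Fin n,
        π (gen X n q q⁻¹ (.e i)) = djGen X n q (.e i) ∧
        π (gen X n q q⁻¹ (.f i)) = djGen X n q (.f i) ∧
        π (gen X n q q⁻¹ (.w i)) = djGen X n q (.k i) ∧
        π (gen X n q q⁻¹ (.wp i)) = djGen X n q (.kInv i)) ∧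
      Function.Surjective π ∧
      TwoSidedIdeal.ker π = TwoSidedIdeal.span (Set.range fun i : Fin n =>
        gen X n q q⁻¹ (.wp i) - gen X n q q⁻¹ (.wInv i)) := by
  obtain ⟨s, Q, -, hs⟩ := exists_presented (X := X) hn hq (inv_ne_zero hq)
  obtain ⟨t, P, -, hk, hk'⟩ := exists_djPresented (X := X) hn hq
  obtain ⟨t', M', hl, hr, hl'⟩ := exists_pairModel hn hq P.toModel
  obtain ⟨π, hπ⟩ := exists_lift hn hq (inv_ne_zero hq) M'
  have hw : ∀ i, π (gen X n q q⁻¹ (.w i)) = djGen X n q (.k i) := fun i =>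
    (hπ (.w i)).trans ((hl i).trans (hk i))
  have hwp : ∀ i, π (gen X n q q⁻¹ (.wp i)) = djGen X n q (.kInv i) := fun i =>
    (hπ (.wp i)).trans ((hr i).trans (hk' i))
  have hwi : ∀ i, π (gen X n q q⁻¹ (.wInv i)) = djGen X n q (.kInv i) := fun i =>
    (hπ (.wInv i)).trans ((hl' i).trans (hk' i))
  refine ⟨π, fun i => ⟨hπ (.e i), hπ (.f i), hw i, hwp i⟩, ?_, le_antisymm ?_ ?_⟩
  · intro x
    obtain ⟨x, rfl⟩ := RingQuot.mkAlgHom_surjective K (DJRel X n q) x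
    induction x using FreeAlgebra.induction with
    | grade0 c => exact ⟨algebraMap K _ c, by simp⟩
    | grade1 g =>
      cases g with
      | e i => exact ⟨_, hπ (.e i)⟩
      | f i => exact ⟨_, hπ (.f i)⟩
      | k i => exact ⟨_, hw i⟩
      | kInv i => exact ⟨_, hwi i⟩
    | mul x y hx hy =>
      obtain ⟨a, ha⟩ := hx
      obtain ⟨b, hb⟩ := hy
      exact ⟨a * b, by rw [map_mul, map_mul, ha, hb]⟩
    | add x y hx hy =>
      obtain ⟨a, ha⟩ := hx
      obtain ⟨b, hb⟩ := hy
      exact ⟨a + b, by rw [map_add, map_add, ha, hb]⟩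
  -- The quotient by `J` is a model of the Drinfeld–Jimbo relations, so the projection `p` factors
  -- as `φ ∘ π`; hence the kernel of `π` lies in that of `p`, which is `J`.
  · set J := TwoSidedIdeal.span (Set.range fun i : Fin n =>
      gen X n q q⁻¹ (.wp i) - gen X n q q⁻¹ (.wInv i)) with hJ
    let p : QGroup X n q q⁻¹ →ₐ[K] J.ringCon.Quotient := RingCon.mkₐ (α := K) J.ringCon
    have hp : ∀ x, p x = 0 ↔ x ∈ J := fun x => by
      conv_rhs => rw [← TwoSidedIdeal.ker_ringCon_mk' J]
      exact (TwoSidedIdeal.mem_ker (f := J.ringCon.mk')).symm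
    have hp' : ∀ i, p (gen X n q q⁻¹ (.wp i)) = p (gen X n q q⁻¹ (.wInv i)) := fun i => by
      rw [← sub_eq_zero, ← map_sub, hp]
      exact TwoSidedIdeal.subset_span ⟨i, rfl⟩
    obtain ⟨t₁, M₁, h1, h1'⟩ := exists_djModel hn hq (model_map Q.toModel p) fun i => by
      have e1 := hs (.wp i) trivial
      have e2 := hs (.wInv i) trivial
      change p (s _) = p (s _)
      rw [← show gen X n q q⁻¹ (.wp i) = s (Datum.mono K (Finsupp.single (.inr i) 1)) from e1,
        ← show gen X n q q⁻¹ (.wInv i) = s (Datum.mono K (-Finsupp.single (.inl i) 1)) from e2,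
        hp' i]
    obtain ⟨φ, hφ⟩ := exists_djLift hn hq M₁
    have hinv : ∀ i, gen X n q q⁻¹ (.wp i) * gen X n q q⁻¹ (.wpInv i) = 1 ∧
        gen X n q q⁻¹ (.wpInv i) * gen X n q q⁻¹ (.wp i) = 1 := fun i => by
      rw [hs (.wp i) trivial, hs (.wpInv i) trivial]
      exact ⟨torus_mul_neg s _, by rw [← map_mul, mul_comm, map_mul]; exact torus_mul_neg s _⟩
    have hφπ : φ.comp π = p := by
      apply RingQuot.ringQuot_ext'
      ext g
      change φ (π (gen X n q q⁻¹ g)) = p (gen X n q q⁻¹ g)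
      have hwp' : ∀ i, φ (π (gen X n q q⁻¹ (.wp i))) = p (gen X n q q⁻¹ (.wp i)) := fun i => by
        rw [hwp, hφ, hp', hs (.wInv i) trivial]; exact h1' i
      cases g with
      | e i => rw [show π (gen X n q q⁻¹ (.e i)) = djGen X n q (.e i) from hπ (.e i), hφ]; rfl
      | f i => rw [show π (gen X n q q⁻¹ (.f i)) = djGen X n q (.f i) from hπ (.f i), hφ]; rfl
      | w i => rw [hw, hφ, hs (.w i) trivial]; exact h1 i
      | wp i => exact hwp' i
      | wInv i => rw [hwi, hφ, hs (.wInv i) trivial]; exact h1' i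
      | wpInv i =>
        -- The two candidates are inverses of the same element, the image of `ω' i`, on which `φ ∘
        -- π` and `p` already agree.
        refine left_inv_eq_right_inv (a := p (gen X n q q⁻¹ (.wp i))) ?_ ?_
        · rw [← hwp', ← map_mul, ← map_mul, (hinv i).2, map_one, map_one]
        · rw [← map_mul, (hinv i).1, map_one]
    intro x hx
    rw [TwoSidedIdeal.mem_ker] at hx
    rw [← hp, ← hφπ, AlgHom.comp_apply, hx, map_zero]
  · rw [TwoSidedIdeal.span_le]
    rintro _ ⟨i, rfl⟩
    rw [SetLike.mem_coe, TwoSidedIdeal.mem_ker, map_sub, hwp, hwi, sub_self]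

end TwoParam

end

theorem corollary2p6 {K : Type*} [Field K] (X : TwoParam.ClassicalType) (n : ℕ)
    (hn : X.minRank ≤ n) :
    -- the two-parameter quantum group
    (∀ r s : K, r ≠ 0 → s ≠ 0 → r ^ 2 ≠ s ^ 2 →
      (∃ Φ : ((TwoParam.negPart X n r s ⊗[K] TwoParam.torPart X n r s) ⊗[K]
            TwoParam.posPart X n r s) ≃ₗ[K] TwoParam.QGroup X n r s,
        ∀ (y : TwoParam.negPart X n r s) (h : TwoParam.torPart X n r s)
          (x : TwoParam.posPart X n r s),
          Φ ((y ⊗ₜ[K] h) ⊗ₜ[K] x) =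
            (y : TwoParam.QGroup X n r s) * (h : TwoParam.QGroup X n r s) *
              (x : TwoParam.QGroup X n r s)) ∧
      (∃ Θ : AddMonoidAlgebra K ((Fin n ⊕ Fin n) →₀ ℤ) ≃ₐ[K] TwoParam.torPart X n r s,
        ∀ i : Fin n,
          (Θ (AddMonoidAlgebra.single (Finsupp.single (Sum.inl i) 1) 1) :
            TwoParam.QGroup X n r s) = TwoParam.gen X n r s (.w i) ∧
          (Θ (AddMonoidAlgebra.single (Finsupp.single (Sum.inr i) 1) 1) :
            TwoParam.QGroup X n r s) = TwoParam.gen X n r s (.wp i))) ∧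
    -- the one-parameter quantum group, and the map that induces its decomposition
    (∀ q : K, q ≠ 0 → q ^ 4 ≠ 1 →
      (∃ π : TwoParam.QGroup X n q q⁻¹ →ₐ[K] TwoParam.DJGroup X n q,
        (∀ i : Fin n,
          π (TwoParam.gen X n q q⁻¹ (.e i)) = TwoParam.djGen X n q (.e i) ∧
          π (TwoParam.gen X n q q⁻¹ (.f i)) = TwoParam.djGen X n q (.f i) ∧
          π (TwoParam.gen X n q q⁻¹ (.w i)) = TwoParam.djGen X n q (.k i) ∧
          π (TwoParam.gen X n q q⁻¹ (.wp i)) = TwoParam.djGen X n q (.kInv i)) ∧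
        Function.Surjective π ∧
        TwoSidedIdeal.ker π = TwoSidedIdeal.span (Set.range fun i : Fin n =>
          TwoParam.gen X n q q⁻¹ (.wp i) - TwoParam.gen X n q q⁻¹ (.wInv i))) ∧
      (∃ Ψ : ((TwoParam.djNegPart X n q ⊗[K] TwoParam.djTorPart X n q) ⊗[K]
            TwoParam.djPosPart X n q) ≃ₗ[K] TwoParam.DJGroup X n q,
        ∀ (y : TwoParam.djNegPart X n q) (h : TwoParam.djTorPart X n q)
          (x : TwoParam.djPosPart X n q),
          Ψ ((y ⊗ₜ[K] h) ⊗ₜ[K] x) =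
            (y : TwoParam.DJGroup X n q) * (h : TwoParam.DJGroup X n q) *
              (x : TwoParam.DJGroup X n q)) ∧
      (∃ Θ : AddMonoidAlgebra K (Fin n →₀ ℤ) ≃ₐ[K] TwoParam.djTorPart X n q,
        ∀ i : Fin n,
          (Θ (AddMonoidAlgebra.single (Finsupp.single i 1) 1) : TwoParam.DJGroup X n q) =
            TwoParam.djGen X n q (.k i))) := by
  refine ⟨fun r s hr hs _ => ?_, fun q hq _ => ⟨TwoParam.exists_specialization hn hq, ?_⟩⟩
  · obtain ⟨t, P, ht, htor⟩ := TwoParam.exists_presented (X := X) hn hr hs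
    obtain ⟨hΦ, Θ, hΘ⟩ := P.exists_equiv (Nn := TwoParam.negPart X n r s) rfl ht
      (Np := TwoParam.posPart X n r s) rfl
    exact ⟨hΦ, Θ, fun i => ⟨(hΘ _).trans (htor (.w i) trivial).symm,
      (hΘ _).trans (htor (.wp i) trivial).symm⟩⟩
  · obtain ⟨t, P, ht, hk, -⟩ := TwoParam.exists_djPresented (X := X) hn hq
    obtain ⟨hΨ, Θ, hΘ⟩ := P.exists_equiv (Nn := TwoParam.djNegPart X n q) rfl ht
      (Np := TwoParam.djPosPart X n q) rfl
    exact ⟨hΨ, Θ, fun i => (hΘ _).trans (hk i)⟩
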